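/- Let $d \ge 0$ be a fixed integer. An instance of Generalized $d$-Sat consists of a set of clauses $C_1,\dots,C_m$ over variables $x_1,\dots,x_n$, where each clause is a set of distinct literals of the form $x_i$ or $\neg x_i$, and, for each clause $C_i$, a finite set $S_i \subset \mathbb{N}_0$ with $|S_i| \le d$. The parameter is the number $n$ of variables, and the question is whether there is a truth assignment such that, for every $i$, the number of satisfied literals of $C_i$ lies in $S_i$. In Generalized $d$-Sat mod $p$, for a fixed prime $p$, the instances are the same and the question is whether there is a truth assignment such that, for every $i$, the number of satisfied literals of $C_i$ modulo $p$ (the remainder in $\{0,\dots,p-1\}$) lies in $S_i$. A kernel of size $h$, for a computable function $h \colon \mathbb{N}_0 \to \mathbb{N}_0$, for a parameterized problem $Q \subseteq \{0,1\}^* \times \mathbb{N}_0$ is an algorithm that, on input $(x,k)$, runs in time polynomial in $|x|+k$ and outputs a pair $(x',k')$ with $|x'|, k' \le h(k)$ and $(x',k') \in Q \iff (x,k) \in Q$. Then Generalized $d$-Sat and, for every prime $p$, Generalized $d$-Sat mod $p$ each have a kernel of size $h(n) = \mathcal{O}(n^{d+1} \log n)$ (in bits; the constants may depend on $d$ and $p$)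 whose output on parameter $n$ is an instance over the same number $n$ of variables with at most $n^d+1$ clauses. Here clauses and the sets $S_i$ are encoded in binary as lists of their elements. -/

import Mathlib

/-! ### Parameterized problems and kernels -/

/-- A parameterized problem over the binary alphabet. -/
abbrev ParamProblem : Type := Set (List Bool × ℕ)

/-- The tape contents for an input or output `(x, k)`: the word `x` followed by `k` in unary.
Its length is `|x| + k`. -/
def encodePair (y : List Bool × ℕ) : List (Option Bool) :=
  y.1.map some ++ List.replicate y.2 none

/-- `f` is a kernel of size `h` for `Q`: it is computed by a Turing machine in time polynomial in
`|x| + k`, its output has word length and parameter at most `h k`, where `h` is computable, and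
it preserves membership in `Q`. -/
structure IsKernel (Q : ParamProblem) (h : ℕ → ℕ) (f : List Bool × ℕ → List Bool × ℕ) :
    Prop where
  computable_size : Computable h
  polyTime : Nonempty (Turing.TM2ComputableInPolyTime encodePair encodePair f)
  length_le : ∀ (x : List Bool) (k : ℕ), (f (x, k)).1.length ≤ h k
  param_le : ∀ (x : List Bool) (k : ℕ), (f (x, k)).2 ≤ h k
  mem_iff : ∀ (x : List Bool) (k : ℕ), f (x, k) ∈ Q ↔ (x, k) ∈ Q

/-! ### Binary encodings -/

/-- Self-delimiting encoding of a list: every entry is preceded by `1`, the end is marked by `0`. -/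
def encodeList {α : Type} (e : α → List Bool) (l : List α) : List Bool :=
  l.flatMap (fun a => true :: e a) ++ [false]

/-- Self-delimiting encoding of the binary expansion of a natural number. -/
def encodeNat (m : ℕ) : List Bool :=
  encodeList (fun b => [b]) m.bits

/-! ### Generalized `d`-Sat -/

/-- A literal over the variables indexed by `Fin n`: `(i, true)` is the variable with index `i`,
and `(i, false)` is its negation. -/
abbrev Literal (n : ℕ) : Type := Fin n × Bool

/-- A clause (a set of literals) with its set `S` of allowed values, where `|S| ≤ d`. Both sets
are written down as lists without repetitions, in any order. -/
structure ConstrainedClause (d n : ℕ) where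
  literals : List (Literal n)
  literals_nodup : literals.Nodup
  allowed : List ℕ
  allowed_nodup : allowed.Nodup
  allowed_length : allowed.length ≤ d

/-- The number of literals of the clause that are satisfied by the assignment `τ`. -/
def ConstrainedClause.numSat {d n : ℕ} (c : ConstrainedClause d n) (τ : Fin n → Bool) : ℕ :=
  c.literals.countP (fun l => τ l.1 == l.2)

/-- An instance on `n` variables: a set of clauses, each with its own set of allowed values,
written down as a list in any order. Distinct entries are distinct as sets of literals. -/
structure GenSatInstance (d n : ℕ) where
  clauses : List (ConstrainedClause d n)
  clauses_distinct :
    clauses.Pairwise (fun c c' => c.literals.toFinset ≠ c'.literals.toFinset)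

/-- Some assignment makes the number of satisfied literals of every clause allowed. -/
def GenSatInstance.Satisfiable {d n : ℕ} (I : GenSatInstance d n) : Prop :=
  ∃ τ : Fin n → Bool, ∀ c ∈ I.clauses, c.numSat τ ∈ c.allowed

/-- Some assignment makes the number of satisfied literals modulo `p` of every clause allowed. -/
def GenSatInstance.SatisfiableMod {d n : ℕ} (p : ℕ) (I : GenSatInstance d n) : Prop :=
  ∃ τ : Fin n → Bool, ∀ c ∈ I.clauses, c.numSat τ % p ∈ c.allowed

/-- Encoding of a literal: the variable index in binary, and a bit for the sign. -/
def encodeLiteral {n : ℕ} (l : Literal n) : List Bool :=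
  encodeNat l.1 ++ [l.2]

/-- Encoding of a clause together with its set of allowed values. -/
def ConstrainedClause.encode {d n : ℕ} (c : ConstrainedClause d n) : List Bool :=
  encodeList encodeLiteral c.literals ++ encodeList encodeNat c.allowed

/-- Encoding of an instance as a bit string (the number of variables is the parameter). -/
def GenSatInstance.encode {d n : ℕ} (I : GenSatInstance d n) : List Bool :=
  encodeList ConstrainedClause.encode I.clauses

/-- Generalized `d`-Sat, parameterized by the number of variables. -/
def genSat (d : ℕ) : ParamProblem :=
  {y | ∃ I : GenSatInstance d y.2, y.1 = I.encode ∧ I.Satisfiable}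

/-- Generalized `d`-Sat mod `p`, parameterized by the number of variables. -/
def genSatMod (d p : ℕ) : ParamProblem :=
  {y | ∃ I : GenSatInstance d y.2, y.1 = I.encode ∧ I.SatisfiableMod p}

/-- The problem `Q`, whose instances are those of Generalized `d`-Sat, has a kernel of bit size
`O(n ^ (d + 1) * log n)` whose outputs are instances on the same `n` variables with at most
`n ^ d + 1` clauses. -/
def HasSparseKernel (d : ℕ) (Q : ParamProblem) : Prop :=
  ∃ (f : List Bool × ℕ → List Bool × ℕ) (h : ℕ → ℕ),
    IsKernel Q h f ∧
    ((fun n : ℕ => (h n : ℝ)) =O[Filter.atTop]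
      fun n : ℕ => (n : ℝ) ^ (d + 1) * Real.log (n : ℝ)) ∧
    ∀ (x : List Bool) (n : ℕ), ∃ I : GenSatInstance d n,
      f (x, n) = (I.encode, n) ∧ I.clauses.length ≤ n ^ d + 1

/-! ### The encoding is uniquely decodable -/

/-- Codewords can be read off unambiguously from the left. -/
def SelfDelimiting {α : Type} (e : α → List Bool) : Prop :=
  ∀ (a b : α) (u v : List Bool), e a ++ u = e b ++ v → a = b ∧ u = v

theorem SelfDelimiting.encodeList {α : Type} {e : α → List Bool} (he : SelfDelimiting e) :
    SelfDelimiting (encodeList e) := by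
  intro a
  induction a with
  | nil =>
    intro b u v h
    cases b with
    | nil => simpa [_root_.encodeList] using h
    | cons b bs => simp [_root_.encodeList] at h
  | cons a as ih =>
    intro b u v h
    cases b with
    | nil => simp [_root_.encodeList] at h
    | cons b bs =>
      simp only [_root_.encodeList, List.flatMap_cons, List.cons_append, List.append_assoc,
        List.cons.injEq, true_and] at h
      obtain ⟨rfl, h2⟩ := he _ _ _ _ h
      obtain ⟨rfl, h3⟩ := ih bs u v (by simpa [_root_.encodeList] using h2)
      exact ⟨rfl, h3⟩

theorem selfDelimiting_encodeNat : SelfDelimiting encodeNat := by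
  intro a b u v h
  have hb : SelfDelimiting (fun b : Bool => [b]) := by
    intro a b u v h
    simpa using h
  obtain ⟨h1, h2⟩ := hb.encodeList _ _ _ _ h
  refine ⟨?_, h2⟩
  have key : ∀ m : ℕ, m.bits.foldr Nat.bit 0 = m := by
    intro m
    induction m using Nat.binaryRec' with
    | zero => simp
    | bit b m hm ih => rw [Nat.bits_append_bit m b hm, List.foldr_cons, ih]
  rw [← key a, ← key b, h1]

theorem selfDelimiting_encodeLiteral {n : ℕ} : SelfDelimiting (encodeLiteral (n := n)) := by
  rintro ⟨a, s⟩ ⟨b, t⟩ u v h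
  simp only [encodeLiteral, List.append_assoc] at h
  obtain ⟨h1, h2⟩ := selfDelimiting_encodeNat _ _ _ _ h
  simp only [List.cons_append, List.nil_append, List.cons.injEq] at h2
  exact ⟨Prod.ext (Fin.ext h1) h2.1, h2.2⟩

theorem selfDelimiting_clause_encode {d n : ℕ} :
    SelfDelimiting (ConstrainedClause.encode (d := d) (n := n)) := by
  rintro ⟨l, hl, s, hs, hd⟩ ⟨l', hl', s', hs', hd'⟩ u v h
  simp only [ConstrainedClause.encode, List.append_assoc] at h
  obtain ⟨rfl, h2⟩ := selfDelimiting_encodeLiteral.encodeList _ _ _ _ h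
  obtain ⟨rfl, h3⟩ := selfDelimiting_encodeNat.encodeList _ _ _ _ h2
  exact ⟨rfl, h3⟩

theorem GenSatInstance.encode_injective {d n : ℕ} :
    Function.Injective (GenSatInstance.encode (d := d) (n := n)) := by
  rintro ⟨I, hI⟩ ⟨J, hJ⟩ h
  obtain ⟨rfl, -⟩ := selfDelimiting_clause_encode.encodeList I J [] []
    (by simpa [GenSatInstance.encode] using h)
  rfl

/-!
The kernel keeps a clause only if its polynomial is needed to span the polynomials of all clauses.
For a prime `q` and a clause with literals `C` and allowed values `S`, the polynomial
`∏ s ∈ S, s < q, (number of satisfied literals of C - s)` over `ZMod q` has degree at most `d` in the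
variables, and it vanishes exactly at the assignments that satisfy the clause modulo `q`
(`clausePoly_eq_zero_iff`). Hence an assignment that satisfies clauses whose polynomials span those
of all clauses satisfies all clauses. For the problem modulo `p` one takes `q = p`; for the problem
without a modulus, `q` is the least prime above `2 * n`, which is greater than every possible count
and at most `4 * n + 2` by Bertrand's postulate (`largePrime_spec`). Allowed values that are not
less than `q` are deleted, so that all numbers in the output have `O(log n)` digits.

A polynomial of degree at most `d` on `{0, 1} ^ n` is determined by its values at the points with at
most `d` ones (`eq_zero_of_mem_degreeLE`). These points are listed, with repetitions, by the empty
set and the `n ^ d` tuples of `d` variables. The algorithm therefore never handles coefficients: it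
eliminates the columns of the matrix of the values of the clause polynomials at these `n ^ d + 1`
points, and keeps the clauses of the pivot rows, at most one for every column. That the
polynomials of the other clauses vanish wherever those of the chosen ones do is
`apply_eq_zero_of_chosen`.

The running time is established for Turing machines by way of a small functional calculus. A
structured program on four stacks (`Cmd`) translates to a `Turing.TM2` machine that needs no more
steps (`Run.stepsTo`). Such programs work on codewords of binary trees in the manner of a stack
language: `PolyTime f` says that some program replaces the codeword of `a` on top of the main stack
by the codeword of `f a` in polynomially many steps, without touching what lies below. This class of
functions is closed under composition, pairing, case distinction, and folds over lists whose
intermediate values are polynomially bounded (`PolyTime.foldl`). Everything else, from unary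
arithmetic and the parser (`IsDecoder.list`) to the elimination, is composed from these operations,
mostly by `fun_prop`. Numbers that are not part of the input word are kept in unary, which is
affordable since the parameter is part of the input length.
-/

/-! ### Structured stack programs and their translation to Turing machines -/

/-- The four stacks of the machines built below. -/
inductive Stk
  | main | left | right | depth
  deriving DecidableEq

instance : Fintype Stk :=
  ⟨{.main, .left, .right, .depth}, fun k => by cases k <;> simp⟩

/-- Structured programs acting on four stacks over the alphabet `Option Bool`. The tests of the
conditional and of the loop inspect the top of one stack. -/
inductive Cmd
  | push (k : Stk) (a : Option Bool)
  | pop (k : Stk)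
  | seq (c₁ c₂ : Cmd)
  | ite (k : Stk) (p : Option (Option Bool) → Bool) (c₁ c₂ : Cmd)
  | loop (k : Stk) (p : Option (Option Bool) → Bool) (c : Cmd)

/-- The contents of the four stacks. -/
abbrev Store : Type := Stk → List (Option Bool)

/-- `Run c S S' t`: started with stack contents `S`, the program `c` ends with `S'` after at most
`t` steps. -/
inductive Run : Cmd → Store → Store → ℕ → Prop
  | push (k a S) : Run (.push k a) S (Function.update S k (a :: S k)) 1
  | pop (k S) : Run (.pop k) S (Function.update S k (S k).tail) 1
  | seq {c₁ c₂ S₁ S₂ S₃ t₁ t₂} (h₁ : Run c₁ S₁ S₂ t₁) (h₂ : Run c₂ S₂ S₃ t₂) :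
      Run (.seq c₁ c₂) S₁ S₃ (t₁ + t₂)
  | ite_true {k p c₁ c₂ S S' t} (hp : p (S k).head? = true) (h : Run c₁ S S' t) :
      Run (.ite k p c₁ c₂) S S' (t + 1)
  | ite_false {k p c₁ c₂ S S' t} (hp : p (S k).head? = false) (h : Run c₂ S S' t) :
      Run (.ite k p c₁ c₂) S S' (t + 1)
  | loop_true {k p c S₁ S₂ S₃ t₁ t₂} (hp : p (S₁ k).head? = true) (h₁ : Run c S₁ S₂ t₁)
      (h₂ : Run (.loop k p c) S₂ S₃ t₂) : Run (.loop k p c) S₁ S₃ (t₁ + t₂ + 1)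
  | loop_false {k p c S} (hp : p (S k).head? = false) : Run (.loop k p c) S S 1
  | mono {c S S' t t'} (h : Run c S S' t) (ht : t ≤ t') : Run c S S' t'

namespace Cmd

/-- The control points of a program. -/
def Lab : Cmd → Type
  | push _ _ => Unit
  | pop _ => Unit
  | seq c₁ c₂ => c₁.Lab ⊕ c₂.Lab
  | ite _ _ c₁ c₂ => Option (c₁.Lab ⊕ c₂.Lab)
  | loop _ _ c => Option c.Lab

theorem finite_lab : ∀ c : Cmd, Finite c.Lab
  | push _ _ => inferInstanceAs (Finite Unit)
  | pop _ => inferInstanceAs (Finite Unit)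
  | seq c₁ c₂ => by
    have := finite_lab c₁
    have := finite_lab c₂
    exact inferInstanceAs (Finite (c₁.Lab ⊕ c₂.Lab))
  | ite _ _ c₁ c₂ => by
    have := finite_lab c₁
    have := finite_lab c₂
    exact inferInstanceAs (Finite (Option (c₁.Lab ⊕ c₂.Lab)))
  | loop _ _ c => by
    have := finite_lab c
    exact inferInstanceAs (Finite (Option c.Lab))

/-- The control point at which a program starts. -/
def entry : (c : Cmd) → c.Lab
  | push _ _ => ()
  | pop _ => ()
  | seq c₁ _ => Sum.inl c₁.entry
  | ite _ _ _ _ => none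
  | loop _ _ _ => none

/-- The machine statement at a control point of `c`, where the control points of `c` are embedded
into the labels of the machine by `e`, and `x` is the label at which to continue after `c`. The
internal state is a bit that is only used to remember the outcome of a test; it is `false`
whenever a control point is reached. -/
def stmt {Λ : Type} :
    (c : Cmd) → (c.Lab → Λ) → Λ → c.Lab → Turing.TM2.Stmt (fun _ : Stk => Option Bool) Λ Bool
  | push k a, _, x, _ => .push k (fun _ => a) (.goto fun _ => x)
  | pop k, _, x, _ => .pop k (fun v _ => v) (.goto fun _ => x)
  | seq c₁ c₂, e, _, .inl l => c₁.stmt (fun l => e (.inl l)) (e (.inr c₂.entry)) l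
  | seq _ c₂, e, x, .inr l => c₂.stmt (fun l => e (.inr l)) x l
  | ite k p c₁ c₂, e, _, none =>
    .peek k (fun _ o => p o)
      (.branch id (.load (fun _ => false) (.goto fun _ => e (some (.inl c₁.entry))))
        (.goto fun _ => e (some (.inr c₂.entry))))
  | ite _ _ c₁ _, e, x, some (.inl l) => c₁.stmt (fun l => e (some (.inl l))) x l
  | ite _ _ _ c₂, e, x, some (.inr l) => c₂.stmt (fun l => e (some (.inr l))) x l
  | loop k p c, e, x, none =>
    .peek k (fun _ o => p o)
      (.branch id (.load (fun _ => false) (.goto fun _ => e (some c.entry))) (.goto fun _ => x))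
  | loop _ _ c, e, _, some l => c.stmt (fun l => e (some l)) (e none) l

end Cmd

/-- The machine `M` gets from the configuration `a` to the configuration `b` in exactly `t` steps. -/
def StepsTo {Λ : Type} (M : Λ → Turing.TM2.Stmt (fun _ : Stk => Option Bool) Λ Bool)
    (a b : Turing.TM2.Cfg (fun _ : Stk => Option Bool) Λ Bool) (t : ℕ) : Prop :=
  (flip bind (Turing.TM2.step M))^[t] (some a) = some b

theorem StepsTo.trans {Λ : Type} {M : Λ → Turing.TM2.Stmt (fun _ : Stk => Option Bool) Λ Bool}
    {a b c : Turing.TM2.Cfg (fun _ : Stk => Option Bool) Λ Bool} {t u : ℕ}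
    (h₁ : StepsTo M a b t) (h₂ : StepsTo M b c u) : StepsTo M a c (u + t) := by
  unfold StepsTo at *
  rw [Function.iterate_add_apply, h₁, h₂]

/-- Correctness of the translation: a machine that contains the statements of `c` simulates `c`, from
the entry point of `c` to the exit label `x`, without any loss of time. -/
theorem Run.stepsTo {c : Cmd} {S S' : Store} {t : ℕ} (h : Run c S S' t) {Λ : Type}
    (M : Λ → Turing.TM2.Stmt (fun _ : Stk => Option Bool) Λ Bool) (e : c.Lab → Λ) (x : Λ)
    (hM : ∀ l, M (e l) = c.stmt e x l) :
    ∃ s ≤ t, StepsTo M ⟨some (e c.entry), false, S⟩ ⟨some x, false, S'⟩ s := by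
  induction h generalizing x with
  | push k a S => exact ⟨1, le_rfl, by simp [StepsTo, flip, hM, Cmd.stmt]⟩
  | pop k S => exact ⟨1, le_rfl, by simp [StepsTo, flip, hM, Cmd.stmt]⟩
  | seq h₁ h₂ ih₁ ih₂ =>
    obtain ⟨s₁, hs₁, r₁⟩ := ih₁ (fun l => e (.inl l)) (e (.inr (Cmd.entry _))) fun l => hM (.inl l)
    obtain ⟨s₂, hs₂, r₂⟩ := ih₂ (fun l => e (.inr l)) x fun l => hM (.inr l)
    exact ⟨s₂ + s₁, by omega, r₁.trans r₂⟩
  | @ite_true k p c₁ c₂ S S' t hp h ih =>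
    obtain ⟨s, hs, r⟩ := ih (fun l => e (some (.inl l))) x fun l => hM (some (.inl l))
    refine ⟨s + 1, by omega, StepsTo.trans ?_ r⟩
    have := hM none
    simp only [Cmd.stmt] at this
    simp [StepsTo, flip, Cmd.entry, this, hp]
  | @ite_false k p c₁ c₂ S S' t hp h ih =>
    obtain ⟨s, hs, r⟩ := ih (fun l => e (some (.inr l))) x fun l => hM (some (.inr l))
    refine ⟨s + 1, by omega, StepsTo.trans ?_ r⟩
    have := hM none
    simp only [Cmd.stmt] at this
    simp [StepsTo, flip, Cmd.entry, this, hp]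
  | @loop_true k p c S₁ S₂ S₃ t₁ t₂ hp h₁ h₂ ih₁ ih₂ =>
    obtain ⟨s₁, hs₁, r₁⟩ := ih₁ (fun l => e (some l)) (e none) fun l => hM (some l)
    obtain ⟨s₂, hs₂, r₂⟩ := ih₂ e x hM
    refine ⟨s₂ + s₁ + 1, by omega, StepsTo.trans ?_ (r₁.trans r₂)⟩
    have := hM none
    simp only [Cmd.stmt] at this
    simp [StepsTo, flip, Cmd.entry, this, hp]
  | @loop_false k p c S hp =>
    refine ⟨1, le_rfl, ?_⟩
    have := hM none
    simp only [Cmd.stmt] at this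
    simp [StepsTo, flip, Cmd.entry, this, hp]
  | mono h ht ih =>
    obtain ⟨s, hs, r⟩ := ih e x hM
    exact ⟨s, hs.trans ht, r⟩

/-- The stack contents `m`, `l`, `r`, `d`. -/
def store (m l r d : List (Option Bool)) : Store
  | .main => m
  | .left => l
  | .right => r
  | .depth => d

section store
variable (m l r d w : List (Option Bool))

@[simp] theorem store_main : store m l r d .main = m := rfl
@[simp] theorem store_left : store m l r d .left = l := rfl
@[simp] theorem store_right : store m l r d .right = r := rfl
@[simp] theorem store_depth : store m l r d .depth = d := rfl

@[simp] theorem update_store_main :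
    Function.update (store m l r d) .main w = store w l r d := by
  funext k; cases k <;> rfl
@[simp] theorem update_store_left :
    Function.update (store m l r d) .left w = store m w r d := by
  funext k; cases k <;> rfl
@[simp] theorem update_store_right :
    Function.update (store m l r d) .right w = store m l w d := by
  funext k; cases k <;> rfl
@[simp] theorem update_store_depth :
    Function.update (store m l r d) .depth w = store m l r w := by
  funext k; cases k <;> rfl

variable {m l r d} {a : Option Bool}

theorem Run.push_main : Run (.push .main a) (store m l r d) (store (a :: m) l r d) 1 := by
  simpa using Run.push .main a (store m l r d)
theorem Run.push_left : Run (.push .left a) (store m l r d) (store m (a :: l) r d) 1 := by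
  simpa using Run.push .left a (store m l r d)
theorem Run.push_right : Run (.push .right a) (store m l r d) (store m l (a :: r) d) 1 := by
  simpa using Run.push .right a (store m l r d)
theorem Run.push_depth : Run (.push .depth a) (store m l r d) (store m l r (a :: d)) 1 := by
  simpa using Run.push .depth a (store m l r d)
theorem Run.pop_main : Run (.pop .main) (store (a :: m) l r d) (store m l r d) 1 := by
  simpa using Run.pop .main (store (a :: m) l r d)
theorem Run.pop_left : Run (.pop .left) (store m (a :: l) r d) (store m l r d) 1 := by
  simpa using Run.pop .left (store m (a :: l) r d)
theorem Run.pop_right : Run (.pop .right) (store m l (a :: r) d) (store m l r d) 1 := by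
  simpa using Run.pop .right (store m l (a :: r) d)
theorem Run.pop_depth : Run (.pop .depth) (store m l r (a :: d)) (store m l r d) 1 := by
  simpa using Run.pop .depth (store m l r (a :: d))

end store

/-- The Turing machine that runs the program `c`, with input and output on the main stack. -/
noncomputable def Cmd.machine (c : Cmd) : Turing.FinTM2 :=
  have := c.finite_lab
  have := Fintype.ofFinite c.Lab
  { K := Stk
    k₀ := .main
    k₁ := .main
    Γ := fun _ => Option Bool
    Λ := Option c.Lab
    main := some c.entry
    σ := Bool
    initialState := false
    Γk₀Fin := inferInstanceAs (Fintype (Option Bool))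
    m := fun l => l.elim .halt (c.stmt some none) }

/-- A program that computes `g` on the codewords of `ea` in polynomially many steps gives a
polynomial-time Turing machine. -/
theorem Cmd.polyTime {α β : Type} {ea : α → List (Option Bool)} {eb : β → List (Option Bool)}
    {f : α → β} (c : Cmd) (k : ℕ)
    (h : ∀ a, Run c (store (ea a) [] [] []) (store (eb (f a)) [] [] []) (((ea a).length + 2) ^ k)) :
    Nonempty (Turing.TM2ComputableInPolyTime ea eb f) := by
  have key : ∀ a, ∃ s ≤ ((ea a).length + 2) ^ k + 1,
      (flip bind c.machine.step)^[s] (some (Turing.initList c.machine (ea a))) =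
        some (Turing.haltList c.machine (eb (f a))) := by
    intro a
    obtain ⟨s, hs, r⟩ := (h a).stepsTo c.machine.m some none fun l => rfl
    -- The exit label of the whole program takes one more step to halt.
    refine ⟨1 + s, by omega, ?_⟩
    have hi : Turing.initList c.machine (ea a) =
        ⟨some (some c.entry), false, store (ea a) [] [] []⟩ := by
      unfold Turing.initList
      congr 1
      funext k
      cases k <;> rfl
    have hh : Turing.haltList c.machine (eb (f a)) =
        ⟨none, false, store (eb (f a)) [] [] []⟩ := by
      unfold Turing.haltList
      congr 1
      funext k
      cases k <;> rfl
    rw [hi, hh]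
    exact r.trans (t := s) (u := 1) rfl
  choose s hs hr using key
  exact ⟨{
    tm := c.machine
    inputAlphabet := Equiv.refl _
    outputAlphabet := Equiv.refl _
    time := (Polynomial.X + 2) ^ k + 1
    outputsFun := fun a =>
      { steps := s a
        evals_in_steps := (congrArg₂ (fun u v : List (Option Bool) =>
          (flip bind c.machine.step)^[s a] (some (Turing.initList c.machine u)) =
            some (Turing.haltList c.machine v)) (List.map_id _) (List.map_id _)).mpr (hr a)
        steps_le_m := by simpa using hs a } }⟩

/-! ### Binary trees on the stacks -/

/-- Binary trees with unlabelled leaves, the universal data type of the machines. -/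
inductive SExp
  | nil
  | cons (x y : SExp)

namespace SExp

/-- The preorder codeword of a tree, as it is stored on a stack. -/
def word : SExp → List (Option Bool)
  | nil => [some false]
  | cons x y => some true :: (x.word ++ y.word)

/-- The length of the codeword. -/
def size : SExp → ℕ
  | nil => 1
  | cons x y => x.size + y.size + 1

theorem length_word (x : SExp) : x.word.length = x.size := by
  induction x with
  | nil => rfl
  | cons x y hx hy => simp [word, size, hx, hy]

theorem none_notMem_word (x : SExp) : none ∉ x.word := by
  induction x with
  | nil => simp [word]
  | cons x y hx hy => simp [word, hx, hy]

theorem size_pos (x : SExp) : 0 < x.size := by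
  cases x <;> simp [size]

end SExp

namespace Cmd

/-- Push `a` onto the left stack, onto the right stack, onto both, or onto none of them. -/
def emit (a : Option Bool) : Bool → Bool → Cmd
  | true, true => .seq (.push .left a) (.push .right a)
  | true, false => .push .left a
  | false, true => .push .right a
  | false, false => .seq (.push .left a) (.pop .left)

theorem run_emit (a : Option Bool) (p q : Bool) (m l r d : List (Option Bool)) :
    Run (emit a p q) (store m l r d)
      (store m (if p then a :: l else l) (if q then a :: r else r) d) 2 := by
  cases p <;> cases q
  · exact .seq .push_left .pop_left
  · exact Run.push_right.mono (Nat.le_succ 1)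
  · exact Run.push_left.mono (Nat.le_succ 1)
  · exact .seq .push_left .push_right

/-- The loop of `shift`: the depth stack counts the subtrees that are still to be read. -/
def shiftLoop (p q : Bool) : Cmd :=
  .loop .depth Option.isSome
    (.ite .main (· == some (some true))
      (.seq (.pop .main) (.seq (emit (some true) p q) (.push .depth none)))
      (.seq (.pop .main) (.seq (emit (some false) p q) (.pop .depth))))

/-- The loop is described by what remains to be run after it has consumed one tree, so that the
claim can be applied to the subtrees in turn. -/
theorem run_shiftLoop (p q : Bool) (x : SExp) {m l r d : List (Option Bool)} {S : Store} {t : ℕ}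
    (h : Run (shiftLoop p q) (store m (if p then x.word.reverse ++ l else l)
      (if q then x.word.reverse ++ r else r) d) S t) :
    Run (shiftLoop p q) (store (x.word ++ m) l r (none :: d)) S (t + 6 * x.size) := by
  induction x generalizing m l r d t with
  | nil =>
    exact (Run.loop_true rfl (.ite_false rfl (.seq .pop_main
      (.seq (run_emit _ _ _ _ _ _ _) .pop_depth))) h).mono (by simp [SExp.size]; omega)
  | cons x y hx hy =>
    have h' := hx (m := y.word ++ m) (l := if p then some true :: l else l)
      (r := if q then some true :: r else r) (d := none :: d) (hy (t := t) (by
        convert h using 2 <;> split_ifs <;> simp [SExp.word]))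
    simp only [SExp.word, List.cons_append, List.append_assoc]
    exact (Run.loop_true rfl (.ite_true rfl (.seq .pop_main
      (.seq (run_emit _ _ _ _ _ _ _) .push_depth))) h').mono (by simp [SExp.size]; omega)

/-- Remove the topmost tree from the main stack, and push its reversed codeword onto the left stack
if `p`, and onto the right stack if `q`. -/
def shift (p q : Bool) : Cmd :=
  .seq (.push .depth none) (shiftLoop p q)

theorem run_shift (p q : Bool) (x : SExp) (m l r : List (Option Bool)) :
    Run (shift p q) (store (x.word ++ m) l r []) (store m (if p then x.word.reverse ++ l else l)
      (if q then x.word.reverse ++ r else r) []) (6 * x.size + 2) :=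
  (Run.seq .push_depth (run_shiftLoop p q x (.loop_false rfl))).mono (by omega)

/-- Move the symbols above the topmost `none` from the left stack to the main stack, and remove
this `none`. -/
def backLeft : Cmd :=
  .seq (.loop .left (· != some none)
    (.ite .left (· == some (some true))
      (.seq (.pop .left) (.push .main (some true)))
      (.seq (.pop .left) (.push .main (some false)))))
    (.pop .left)

/-- Move the symbols above the topmost `none` from the right stack to the main stack, and remove
this `none`. -/
def backRight : Cmd :=
  .seq (.loop .right (· != some none)
    (.ite .right (· == some (some true))
      (.seq (.pop .right) (.push .main (some true)))
      (.seq (.pop .right) (.push .main (some false)))))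
    (.pop .right)

theorem run_backLeft (w : List (Option Bool)) (hw : none ∉ w) (m l r d : List (Option Bool)) :
    Run backLeft (store m (w ++ none :: l) r d) (store (w.reverse ++ m) l r d)
      (4 * w.length + 2) := by
  refine (Run.seq (t₁ := 4 * w.length + 1) ?_ (.pop_left (a := none))).mono le_rfl
  induction w generalizing m with
  | nil => exact .loop_false rfl
  | cons a w ih =>
    have ih' := ih (fun h => hw (List.mem_cons_of_mem _ h)) (a :: m)
    rcases a with _ | _ | _
    · simp at hw
    · simpa [mul_add] using (Run.loop_true rfl (.ite_false rfl (.seq .pop_left .push_main)) ih').mono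
        (by omega)
    · simpa [mul_add] using (Run.loop_true rfl (.ite_true rfl (.seq .pop_left .push_main)) ih').mono
        (by omega)

theorem run_backRight (w : List (Option Bool)) (hw : none ∉ w) (m l r d : List (Option Bool)) :
    Run backRight (store m l (w ++ none :: r) d) (store (w.reverse ++ m) l r d)
      (4 * w.length + 2) := by
  refine (Run.seq (t₁ := 4 * w.length + 1) ?_ (.pop_right (a := none))).mono le_rfl
  induction w generalizing m with
  | nil => exact .loop_false rfl
  | cons a w ih =>
    have ih' := ih (fun h => hw (List.mem_cons_of_mem _ h)) (a :: m)
    rcases a with _ | _ | _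
    · simp at hw
    · simpa [mul_add] using (Run.loop_true rfl (.ite_false rfl (.seq .pop_right .push_main)) ih').mono
        (by omega)
    · simpa [mul_add] using (Run.loop_true rfl (.ite_true rfl (.seq .pop_right .push_main)) ih').mono
        (by omega)

theorem run_backLeft_word (x : SExp) (m l r d : List (Option Bool)) :
    Run backLeft (store m (x.word.reverse ++ none :: l) r d) (store (x.word ++ m) l r d)
      (4 * x.size + 2) := by
  simpa [x.length_word] using
    run_backLeft x.word.reverse (by simpa using x.none_notMem_word) m l r d

theorem run_backRight_word (x : SExp) (m l r d : List (Option Bool)) :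
    Run backRight (store m l (x.word.reverse ++ none :: r) d) (store (x.word ++ m) l r d)
      (4 * x.size + 2) := by
  simpa [x.length_word] using
    run_backRight x.word.reverse (by simpa using x.none_notMem_word) m l r d

/-- Remove the topmost tree of the main stack. -/
def drop : Cmd := shift false false

theorem run_drop (x : SExp) (m l r : List (Option Bool)) :
    Run drop (store (x.word ++ m) l r []) (store m l r []) (6 * x.size + 2) :=
  run_shift false false x m l r

/-- Move the topmost tree of the main stack to the left stack, above a mark. -/
def stash : Cmd := .seq (.push .left none) (shift true false)

theorem run_stash (x : SExp) (m l r : List (Option Bool)) :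
    Run stash (store (x.word ++ m) l r []) (store m (x.word.reverse ++ none :: l) r [])
      (6 * x.size + 3) :=
  (Run.seq .push_left (run_shift true false x m _ r)).mono (by omega)

/-- Duplicate the topmost tree of the main stack. -/
def dup : Cmd :=
  .seq (.push .left none) (.seq (.push .right none) (.seq (shift true true)
    (.seq backLeft backRight)))

theorem run_dup (x : SExp) (m l r : List (Option Bool)) :
    Run dup (store (x.word ++ m) l r []) (store (x.word ++ (x.word ++ m)) l r [])
      (14 * x.size + 8) :=
  (Run.seq .push_left (.seq .push_right (.seq (run_shift true true x m _ _)
    (.seq (run_backLeft_word _ _ _ _ _) (run_backRight_word _ _ _ _ _))))).mono (by omega)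

/-- Exchange the two topmost trees of the main stack. -/
def swap : Cmd :=
  .seq stash (.seq (.push .right none) (.seq (shift false true) (.seq backLeft backRight)))

theorem run_swap (x y : SExp) (m l r : List (Option Bool)) :
    Run swap (store (x.word ++ (y.word ++ m)) l r []) (store (y.word ++ (x.word ++ m)) l r [])
      (10 * (x.size + y.size) + 10) :=
  (Run.seq (run_stash x _ l r) (.seq .push_right (.seq (run_shift false true y m _ _)
    (.seq (run_backLeft_word _ _ _ _ _) (run_backRight_word _ _ _ _ _))))).mono (by omega)

/-- Push the word `w` onto the main stack. -/
def pushWord : List (Option Bool) → Cmd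
  | [] => .seq (.push .main none) (.pop .main)
  | a :: w => .seq (pushWord w) (.push .main a)

theorem run_pushWord (w m l r d : List (Option Bool)) :
    Run (pushWord w) (store m l r d) (store (w ++ m) l r d) (w.length + 2) := by
  induction w with
  | nil => exact (Run.seq .push_main .pop_main).mono le_rfl
  | cons a w ih => exact (Run.seq ih .push_main).mono (by simp only [List.length_cons]; omega)

end Cmd

/-! ### Polynomial-time functions between coded types -/

/-- A type whose elements are represented by trees. -/
class Code (α : Type) where
  /-- The tree that represents an element. -/
  code : α → SExp

open Code

section instances
variable {α β : Type} [Code α] [Code β]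

instance : Code Unit := ⟨fun _ => .nil⟩
instance : Code Bool := ⟨fun b => bif b then .cons .nil .nil else .nil⟩
instance : Code (α × β) := ⟨fun p => .cons (code p.1) (code p.2)⟩
instance : Code (List α) := ⟨fun l => l.foldr (fun a x => .cons (code a) x) .nil⟩
instance : Code (Option α) := ⟨fun o => code o.toList⟩
/-- Natural numbers are represented in unary. -/
instance : Code ℕ := ⟨fun n => code (List.replicate n ())⟩
end instances

/-- The length of the codeword of an element. -/
def csize {α : Type} [Code α] (a : α) : ℕ := (code a).size

section csize
variable {α β : Type} [Code α] [Code β]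

theorem csize_pos (a : α) : 0 < csize a := SExp.size_pos _

@[simp] theorem csize_unit (a : Unit) : csize a = 1 := rfl
theorem csize_bool_le (b : Bool) : csize b ≤ 3 := by cases b <;> decide
@[simp] theorem csize_prod (p : α × β) : csize p = csize p.1 + csize p.2 + 1 := rfl
@[simp] theorem csize_nil : csize ([] : List α) = 1 := rfl
@[simp] theorem csize_cons (a : α) (l : List α) : csize (a :: l) = csize a + csize l + 1 := rfl
@[simp] theorem csize_none : csize (none : Option α) = 1 := rfl
@[simp] theorem csize_some (a : α) : csize (some a) = csize a + 2 := rfl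

theorem csize_list (l : List α) : csize l = (l.map fun a => csize a + 1).sum + 1 := by
  induction l with
  | nil => rfl
  | cons a l ih => simp [ih]; omega

@[simp] theorem csize_nat (n : ℕ) : csize n = 2 * n + 1 := by
  change csize (List.replicate n ()) = _
  simp [csize_list]; omega

@[simp] theorem csize_append (l l' : List α) : csize (l ++ l') + 1 = csize l + csize l' := by
  simp [csize_list]; omega

theorem csize_le_of_mem {a : α} {l : List α} (h : a ∈ l) : csize a + 2 ≤ csize l := by
  induction l with
  | nil => simp at h
  | cons b l ih =>
    have := csize_pos b
    have := csize_pos l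
    rcases List.mem_cons.1 h with rfl | h
    · simp; omega
    · have := ih h
      simp; omega

theorem csize_sublist {l l' : List α} (h : l.Sublist l') : csize l ≤ csize l' := by
  simp only [csize_list]
  have := (h.map fun a => csize a + 1).sum_le_sum (fun _ _ => Nat.zero_le _)
  omega

theorem length_lt_csize (l : List α) : 2 * l.length < csize l := by
  induction l with
  | nil => simp
  | cons a l ih => have := csize_pos a; simp; omega

theorem csize_list_le {l : List α} {B : ℕ} (h : ∀ a ∈ l, csize a ≤ B) :
    csize l ≤ l.length * (B + 1) + 1 := by
  induction l with
  | nil => simp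
  | cons a l ih =>
    have h1 := h a (by simp)
    have h2 := ih fun a ha => h a (by simp [ha])
    simp only [csize_cons, List.length_cons, add_mul]
    omega

@[simp] theorem csize_reverse (l : List α) : csize l.reverse = csize l := by
  simp only [csize_list, List.map_reverse, List.sum_reverse]

end csize

/-- `t` is bounded by a polynomial in the size of its argument. -/
def PolyBound {α : Type} [Code α] (t : α → ℕ) : Prop :=
  ∃ k, ∀ a, t a ≤ (csize a + 2) ^ k

namespace PolyBound
variable {α β : Type} [Code α] [Code β] {t u : α → ℕ}

theorem mono (h : PolyBound u) (htu : ∀ a, t a ≤ u a) : PolyBound t :=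
  let ⟨k, hk⟩ := h
  ⟨k, fun a => (htu a).trans (hk a)⟩

theorem const (c : ℕ) : PolyBound fun _ : α => c :=
  ⟨c, fun a => Nat.lt_two_pow_self.le.trans (Nat.pow_le_pow_left (by omega) _)⟩

theorem add (ht : PolyBound t) (hu : PolyBound u) : PolyBound fun a => t a + u a := by
  obtain ⟨k, hk⟩ := ht
  obtain ⟨k', hk'⟩ := hu
  refine ⟨max k k' + 1, fun a => ?_⟩
  have h1 : (csize a + 2) ^ k ≤ (csize a + 2) ^ max k k' :=
    Nat.pow_le_pow_right (by omega) (le_max_left _ _)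
  have h2 : (csize a + 2) ^ k' ≤ (csize a + 2) ^ max k k' :=
    Nat.pow_le_pow_right (by omega) (le_max_right _ _)
  rw [pow_succ, mul_add]
  have := hk a
  have := hk' a
  nlinarith [Nat.zero_le ((csize a + 2) ^ max k k' * csize a)]

theorem mul (ht : PolyBound t) (hu : PolyBound u) : PolyBound fun a => t a * u a := by
  obtain ⟨k, hk⟩ := ht
  obtain ⟨k', hk'⟩ := hu
  exact ⟨k + k', fun a => by rw [pow_add]; exact Nat.mul_le_mul (hk a) (hk' a)⟩

theorem pow (ht : PolyBound t) (n : ℕ) : PolyBound fun a => t a ^ n := by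
  obtain ⟨k, hk⟩ := ht
  exact ⟨k * n, fun a => by rw [pow_mul]; exact Nat.pow_le_pow_left (hk a) _⟩

theorem csize : PolyBound fun a : α => csize a := ⟨1, fun a => by simp⟩

theorem comp {v : β → ℕ} (hv : PolyBound v) {f : α → β} (hf : PolyBound fun a => _root_.csize (f a)) :
    PolyBound fun a => v (f a) := by
  obtain ⟨k, hk⟩ := hv
  exact ((hf.add (const 2)).pow k).mono fun a => hk _

end PolyBound

/-- `f` is computed in polynomially many steps by a program that replaces the codeword of the
argument on top of the main stack by the codeword of the value, and leaves everything below it and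
the auxiliary stacks as they were. -/
@[fun_prop]
def PolyTime {α β : Type} [Code α] [Code β] (f : α → β) : Prop :=
  ∃ (c : Cmd) (t : α → ℕ), PolyBound t ∧ (∀ a, csize (f a) ≤ t a) ∧
    ∀ a m l r, Run c (store ((code a).word ++ m) l r []) (store ((code (f a)).word ++ m) l r []) (t a)

namespace PolyTime
variable {α β γ δ : Type} [Code α] [Code β] [Code γ] [Code δ]

theorem polyBound {f : α → β} (hf : PolyTime f) : PolyBound fun a => csize (f a) :=
  let ⟨_, _, ht, hs, _⟩ := hf
  ht.mono hs

theorem congr {f g : α → β} (hg : PolyTime g) (h : ∀ a, f a = g a) : PolyTime f :=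
  (funext h : f = g) ▸ hg

theorem of_code_eq {f : α → β} (h : ∀ a, code (f a) = code a) : PolyTime f := by
  refine ⟨.pushWord [], fun a => csize a + 2, .add .csize (.const _), fun a => ?_,
    fun a m l r => ?_⟩
  · simp [csize, h]
  · rw [h]
    exact (Cmd.run_pushWord [] _ _ _ _).mono (by simp)

@[fun_prop]
theorem id : PolyTime fun a : α => a := of_code_eq fun _ => rfl

@[fun_prop]
theorem comp {f : β → γ} {g : α → β} (hf : PolyTime f) (hg : PolyTime g) :
    PolyTime fun a => f (g a) := by
  have hb := hg.polyBound
  obtain ⟨c, t, ht, hs, hr⟩ := hf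
  obtain ⟨c', t', ht', hs', hr'⟩ := hg
  exact ⟨.seq c' c, fun a => t' a + t (g a), ht'.add (ht.comp hb),
    fun a => (hs _).trans (Nat.le_add_left _ _), fun a m l r => .seq (hr' a m l r) (hr _ m l r)⟩

@[fun_prop]
theorem const (b : β) : PolyTime fun _ : α => b :=
  ⟨.seq .drop (.pushWord (code b).word), fun a => 6 * csize a + (csize b + 4),
    .add (.mul (.const _) .csize) (.const _), fun a => by dsimp only; omega, fun a m l r =>
    (Run.seq (Cmd.run_drop _ _ _ _) (Cmd.run_pushWord _ _ _ _ _)).mono (by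
      simp [csize, SExp.length_word]; omega)⟩

@[fun_prop]
theorem prodMk {f : α → β} {g : α → γ} (hf : PolyTime f) (hg : PolyTime g) :
    PolyTime fun a => (f a, g a) := by
  have hb := hg.polyBound
  obtain ⟨c, t, ht, hs, hr⟩ := hf
  obtain ⟨c', t', ht', hs', hr'⟩ := hg
  refine ⟨.seq .dup (.seq c' (.seq .swap (.seq c (.push .main (some true))))),
    fun a => 24 * csize a + t a + t' a + 10 * csize (g a) + 19,
    .add (.add (.add (.add (.mul (.const _) .csize) ht) ht') (.mul (.const _) hb)) (.const _),
    fun a => ?_, fun a m l r => ?_⟩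
  · have := hs a
    have := hs' a
    simp only [csize_prod]
    omega
  · have h := Run.seq (Cmd.run_dup (code a) m l r) (.seq (hr' a _ l r) (.seq
      (Cmd.run_swap (code (g a)) (code a) m l r) (.seq (hr a _ l r)
      (Run.push_main (a := some true)))))
    rw [← List.append_assoc] at h
    exact h.mono (by simp only [csize]; omega)

theorem fst' : PolyTime fun p : α × β => p.1 :=
  ⟨.seq (.pop .main) (.seq .swap .drop), fun p => 16 * csize p + 13,
    .add (.mul (.const _) .csize) (.const _), fun p => by simp only [csize_prod]; omega,
    fun p m l r => by
      have h := Run.seq (Run.pop_main (a := some true)) (.seq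
        (Cmd.run_swap (code p.1) (code p.2) m l r) (Cmd.run_drop (code p.2) _ l r))
      rw [← List.append_assoc] at h
      exact h.mono (by simp only [csize_prod]; simp only [csize]; omega)⟩

theorem snd' : PolyTime fun p : α × β => p.2 :=
  ⟨.seq (.pop .main) .drop, fun p => 16 * csize p + 13,
    .add (.mul (.const _) .csize) (.const _), fun p => by simp only [csize_prod]; omega,
    fun p m l r => by
      have h := Run.seq (Run.pop_main (a := some true))
        (Cmd.run_drop (code p.1) ((code p.2).word ++ m) l r)
      rw [← List.append_assoc] at h
      exact h.mono (by simp only [csize_prod]; simp only [csize]; omega)⟩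

@[fun_prop]
theorem fst {f : α → β × γ} (hf : PolyTime f) : PolyTime fun a => (f a).1 := fst'.comp hf

@[fun_prop]
theorem snd {f : α → β × γ} (hf : PolyTime f) : PolyTime fun a => (f a).2 := snd'.comp hf

@[fun_prop]
theorem cond {b : α → Bool} {f g : α → β} (hb : PolyTime b) (hf : PolyTime f) (hg : PolyTime g) :
    PolyTime fun a => bif b a then f a else g a := by
  have hp : PolyTime fun a => (b a, a) := hb.prodMk id
  obtain ⟨c, t, ht, hs, hr⟩ := hf
  obtain ⟨c', t', ht', hs', hr'⟩ := hg
  suffices h : PolyTime fun p : Bool × α => bif p.1 then f p.2 else g p.2 from h.comp hp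
  have hsnd : PolyBound fun p : Bool × α => csize p.2 := snd'.polyBound
  refine ⟨.seq (.pop .main) (.ite .main (· == some (some true)) (.seq .drop c)
      (.seq (.pop .main) c')), fun p => t p.2 + t' p.2 + 40,
    .add (.add (ht.comp hsnd) (ht'.comp hsnd)) (.const _), ?_, ?_⟩
  · rintro ⟨_ | _, a⟩
    · have := hs' a
      dsimp only [cond_false]; omega
    · have := hs a
      dsimp only [cond_true]; omega
  · rintro ⟨_ | _, a⟩ m l r
    · exact (Run.seq .pop_main (.ite_false rfl (.seq .pop_main (hr' a m l r)))).mono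
        (by dsimp only; omega)
    · exact (Run.seq .pop_main (.ite_true rfl (.seq (Cmd.run_drop (.cons .nil .nil) _ l r)
        (hr a m l r)))).mono (by simp only [SExp.size]; omega)

@[fun_prop]
theorem list_cons {f : α → β} {g : α → List β} (hf : PolyTime f) (hg : PolyTime g) :
    PolyTime fun a => f a :: g a :=
  (of_code_eq (f := fun p : β × List β => p.1 :: p.2) fun _ => rfl).comp (hf.prodMk hg)

/-- Case distinction on a list, as a function to which `fun_prop` applies. -/
def _root_.List.caseList {α β : Type} (l : List α) (z : β) (s : α → List α → β) : β :=
  match l with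
  | [] => z
  | a :: l => s a l

@[simp]
theorem _root_.List.caseList_nil {α β : Type} (z : β) (s : α → List α → β) :
    [].caseList z s = z := rfl

@[simp]
theorem _root_.List.caseList_cons {α β : Type} (a : α) (l : List α) (z : β) (s : α → List α → β) :
    (a :: l).caseList z s = s a l := rfl

@[fun_prop]
theorem caseList {l : α → List β} {z : α → γ} {s : α → β → List β → γ} (hl : PolyTime l)
    (hz : PolyTime z) (hs : PolyTime fun p : α × β × List β => s p.1 p.2.1 p.2.2) :
    PolyTime fun a => (l a).caseList (z a) (s a) := by
  have hp : PolyTime fun a => (l a, a) := hl.prodMk id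
  have hs' : PolyTime fun p : (β × List β) × α => s p.2 p.1.1 p.1.2 :=
    hs.comp (snd'.prodMk fst')
  obtain ⟨c, t, ht, hs, hr⟩ := hz
  obtain ⟨c', t', ht', hs', hr'⟩ := hs'
  suffices h : PolyTime fun p : List β × α => p.1.caseList (z p.2) (s p.2) from h.comp hp
  have hsnd : PolyBound fun p : List β × α => csize p.2 := snd'.polyBound
  let u : List β × α → ℕ := fun p => p.1.caseList 0 fun b l => t' ((b, l), p.2)
  have hu : PolyBound u := by
    obtain ⟨k, hk⟩ := ht'
    refine ⟨k, ?_⟩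
    rintro ⟨_ | ⟨b, l⟩, a⟩
    · exact Nat.zero_le _
    · exact hk ((b, l), a)
  refine ⟨.seq (.pop .main) (.ite .main (· == some (some true)) (.seq (.push .main (some true)) c')
      (.seq (.pop .main) c)), fun p => t p.2 + u p + 4,
    .add (.add (ht.comp hsnd) hu) (.const _), ?_, ?_⟩
  · rintro ⟨_ | ⟨b, l⟩, a⟩
    · have := hs a
      dsimp only [List.caseList]; omega
    · have := hs' ((b, l), a)
      dsimp only [List.caseList, u] at this ⊢; omega
  · rintro ⟨_ | ⟨b, l⟩, a⟩ m l' r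
    · exact (Run.seq .pop_main (.ite_false rfl (.seq .pop_main (hr a m l' r)))).mono
        (by dsimp only; omega)
    · exact (Run.seq .pop_main (.ite_true rfl (.seq .push_main (hr' ((b, l), a) m l' r)))).mono
        (by dsimp only [List.caseList, u]; omega)

/-- The loop that folds `g` over the list `l`, with initial value `s` below `l` on the main stack.
During a step the rest of the list waits on the left stack. The bound `B` is for the time of the
steps, and `Z` is for the size of the list. -/
theorem run_foldl_loop {g : β × γ → γ} {c : Cmd} {t : β × γ → ℕ}
    (hr : ∀ a m l r, Run c (store ((code a).word ++ m) l r [])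
      (store ((code (g a)).word ++ m) l r []) (t a)) (B Z : ℕ) (m lt r : List (Option Bool))
    (l : List β) (s : γ) (hZ : csize l ≤ Z)
    (hB : ∀ l₁ b l₂, l = l₁ ++ b :: l₂ → t (b, l₁.foldl (fun s b => g (b, s)) s) ≤ B) :
    Run (.loop .main (· == some (some true)) (.seq (.pop .main) (.seq .swap (.seq .stash
      (.seq (.push .main (some true)) (.seq c .backLeft))))))
      (store ((code l).word ++ ((code s).word ++ m)) lt r [])
      (store (some false :: ((code (l.foldl (fun s b => g (b, s)) s)).word ++ m)) lt r [])
      (l.length * (B + 20 * Z + 20) + 1) := by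
  induction l generalizing s with
  | nil => exact (Run.loop_false rfl).mono (by simp)
  | cons b l ih =>
    have hZ' : csize b + csize l + 1 ≤ Z := hZ
    have ih' := ih (g (b, s)) (by omega) fun l₁ b' l₂ h => hB (b :: l₁) b' l₂ (by simp [h])
    have hB' : t (b, s) ≤ B := hB [] b l rfl
    have h₂ := hr (b, s) m ((code l).word.reverse ++ none :: lt) r
    simp only [code, SExp.word, List.cons_append, List.append_assoc] at h₂
    have h₁ := Run.seq (Run.pop_main (a := some true)) (.seq (Cmd.run_swap (code b) (code l)
      ((code s).word ++ m) lt r) (.seq (Cmd.run_stash (code l) _ lt r)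
      (.seq .push_main (.seq h₂ (Cmd.run_backLeft_word (code l) _ lt r [])))))
    rw [← List.append_assoc] at h₁
    refine (Run.loop_true rfl h₁ ih').mono ?_
    simp only [List.length_cons, add_mul]
    simp only [csize] at hZ'
    omega

/-- Folding without access to the environment `a`. -/
theorem foldl_aux {l : α → List β} {s : α → γ} {g : β × γ → γ} (hl : PolyTime l) (hs : PolyTime s)
    (hg : PolyTime g) {b : α → ℕ} (hb : PolyBound b)
    (hbound : ∀ a l₁, l₁ <+: l a → csize (l₁.foldl (fun s b => g (b, s)) (s a)) ≤ b a) :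
    PolyTime fun a => (l a).foldl (fun s b => g (b, s)) (s a) := by
  have hlb := hl.polyBound
  obtain ⟨c₀, t₀, ht₀, hs₀, hr₀⟩ := hl.prodMk hs
  obtain ⟨c, t, ⟨k, hk⟩, -, hr⟩ := hg
  refine ⟨.seq c₀ (.seq (.pop .main) (.seq (.loop .main (· == some (some true)) (.seq (.pop .main)
    (.seq .swap (.seq .stash (.seq (.push .main (some true)) (.seq c .backLeft))))))
    (.pop .main))), fun a => t₀ a + (csize (l a) * ((csize (l a) + b a + 3) ^ k + 20 * csize (l a)
      + 20) + 3 + b a), ht₀.add (((hlb.mul (.add (.add (.pow (.add (.add hlb hb) (.const _)) k)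
      (.mul (.const _) hlb)) (.const _))).add (.const _)).add hb), fun a => ?_, fun a m lt r => ?_⟩
  · have := hbound a _ (List.prefix_rfl)
    dsimp only
    omega
  · have h := run_foldl_loop hr ((csize (l a) + b a + 3) ^ k) (csize (l a)) m lt r (l a) (s a)
      le_rfl fun l₁ b' l₂ h => (hk _).trans (Nat.pow_le_pow_left (by
        have h1 := hbound a l₁ (by rw [h]; exact List.prefix_append _ _)
        have h2 := csize_le_of_mem (a := b') (l := l a) (by simp [h])
        simp only [csize_prod]
        omega) k)
    have h₀ := hr₀ a m lt r
    simp only [code, SExp.word, List.cons_append, List.append_assoc] at h₀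
    refine (Run.seq h₀ (.seq .pop_main (.seq h .pop_main))).mono ?_
    have : (l a).length ≤ csize (l a) := by have := length_lt_csize (l a); omega
    have := Nat.mul_le_mul_right ((csize (l a) + b a + 3) ^ k + 20 * csize (l a) + 20) this
    dsimp only
    omega

/-- Folding a polynomial-time function over a list is polynomial-time, provided that all
intermediate values are polynomially bounded. -/
theorem foldl {l : α → List β} {s : α → γ} {g : α → γ → β → γ} (hl : PolyTime l) (hs : PolyTime s)
    (hg : PolyTime fun p : α × γ × β => g p.1 p.2.1 p.2.2) {b : α → ℕ} (hb : PolyBound b)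
    (hbound : ∀ a l₁, l₁ <+: l a → csize (l₁.foldl (g a) (s a)) ≤ b a) :
    PolyTime fun a => (l a).foldl (g a) (s a) := by
  -- The environment is carried along in the state.
  let g' : β × γ × α → γ × α := fun p => (g p.2.2 p.2.1 p.1, p.2.2)
  have hg' : PolyTime g' :=
    (hg.comp (f := fun p : α × γ × β => g p.1 p.2.1 p.2.2)
      (g := fun p : β × γ × α => (p.2.2, p.2.1, p.1)) (by fun_prop)).prodMk (by fun_prop)
  have key : ∀ (a : α) (l₁ : List β) (s : γ),
      l₁.foldl (fun s b => g' (b, s)) (s, a) = (l₁.foldl (g a) s, a) := by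
    intro a l₁
    induction l₁ with
    | nil => simp
    | cons b l₁ ih => intro s; simp [ih, g']
  have := (foldl_aux hl (hs.prodMk id) hg' (hb.add (.add .csize (.const 1))) (fun a l₁ h => by
    have := hbound a l₁ h
    rw [key]
    simp only [csize_prod]
    omega)).fst
  simpa only [key] using this

/-- A fold in which every step adds only polynomially many symbols. -/
theorem foldl_of_le_add {l : α → List β} {s : α → γ} {g : α → γ → β → γ} (hl : PolyTime l)
    (hs : PolyTime s) (hg : PolyTime fun p : α × γ × β => g p.1 p.2.1 p.2.2) {t : α → ℕ}
    (ht : PolyBound t) (hle : ∀ a, ∀ b ∈ l a, ∀ s, csize (g a s b) ≤ csize s + t a) :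
    PolyTime fun a => (l a).foldl (g a) (s a) := by
  refine foldl hl hs hg (hs.polyBound.add (hl.polyBound.mul ht)) fun a l₁ h => ?_
  have key : ∀ (l₁ : List β) (s : γ), (∀ b ∈ l₁, b ∈ l a) →
      csize (l₁.foldl (g a) s) ≤ csize s + l₁.length * t a := by
    intro l₁
    induction l₁ with
    | nil => simp
    | cons b l₁ ih =>
      intro s h
      have h1 := ih (g a s b) fun b hb => h b (by simp [hb])
      have h2 := hle a b (h b (by simp)) s
      simp only [List.foldl_cons, List.length_cons, add_mul]
      omega
  refine (key l₁ (s a) fun b hb => h.subset hb).trans (Nat.add_le_add_left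
    (Nat.mul_le_mul_right _ ?_) _)
  have := h.length_le
  have := length_lt_csize (l a)
  omega

end PolyTime

/-! ### Lists, Booleans and unary numbers in polynomial time -/

namespace PolyTime
variable {α β γ δ : Type} [Code α] [Code β] [Code γ] [Code δ]

/-- Values at the entries of a polynomial-time list are polynomially bounded. -/
theorem exists_polyBound_of_mem {f : α → β → γ} {l : α → List β}
    (hf : PolyTime fun p : α × β => f p.1 p.2) (hl : PolyTime l) :
    ∃ t : α → ℕ, PolyBound t ∧ ∀ a, ∀ b ∈ l a, csize (f a b) ≤ t a := by
  obtain ⟨k, hk⟩ := hf.polyBound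
  refine ⟨fun a => (csize a + csize (l a) + 1 + 2) ^ k,
    .pow (.add (.add (.add .csize hl.polyBound) (.const _)) (.const _)) _, fun a b hb => ?_⟩
  refine (hk (a, b)).trans (Nat.pow_le_pow_left ?_ _)
  have := csize_le_of_mem hb
  simp only [csize_prod]
  omega

@[fun_prop]
theorem reverse {l : α → List β} (hl : PolyTime l) : PolyTime fun a => (l a).reverse := by
  have : PolyTime fun a => (l a).foldl (fun s b => b :: s) [] :=
    foldl_of_le_add hl (by fun_prop) (by fun_prop) hl.polyBound fun a b hb s => by
      have := csize_le_of_mem hb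
      simp only [csize_cons]; omega
  simpa using this

@[fun_prop]
theorem append {l l' : α → List β} (hl : PolyTime l) (hl' : PolyTime l') :
    PolyTime fun a => l a ++ l' a := by
  have : PolyTime fun a => (l a).reverse.foldl (fun s b => b :: s) (l' a) :=
    foldl_of_le_add (by fun_prop) (by fun_prop) (by fun_prop) hl.polyBound fun a b hb s => by
      have := csize_le_of_mem (List.mem_reverse.1 hb)
      simp only [csize_cons]; omega
  simpa using this

@[fun_prop]
theorem flatMap {l : α → List β} {f : α → β → List γ} (hl : PolyTime l)
    (hf : PolyTime fun p : α × β => f p.1 p.2) : PolyTime fun a => (l a).flatMap (f a) := by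
  obtain ⟨t, ht, hle⟩ := exists_polyBound_of_mem hf hl
  have : PolyTime fun a => (l a).foldl (fun s b => s ++ f a b) [] :=
    foldl_of_le_add hl (by fun_prop)
      (append (by fun_prop) (hf.comp (g := fun p : α × List γ × β => (p.1, p.2.2)) (by fun_prop)))
      ht fun a b hb s => by
        have := hle a b hb
        have := csize_append s (f a b)
        omega
  have key : ∀ (l : List β) (f : β → List γ) (s : List γ),
      l.foldl (fun s b => s ++ f b) s = s ++ l.flatMap f := by
    intro l f
    induction l with
    | nil => simp
    | cons b l ih => intro s; simp [ih]
  simpa only [key, List.nil_append] using this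

@[fun_prop]
theorem map {l : α → List β} {f : α → β → γ} (hl : PolyTime l)
    (hf : PolyTime fun p : α × β => f p.1 p.2) : PolyTime fun a => (l a).map (f a) := by
  have : PolyTime fun a => (l a).flatMap fun b => [f a b] := by fun_prop
  simpa [← List.map_eq_flatMap] using this

@[fun_prop]
theorem bnot {p : α → Bool} (hp : PolyTime p) : PolyTime fun a => !p a := by
  have : PolyTime fun a => bif p a then false else true := by fun_prop
  simpa using this

@[fun_prop]
theorem band {p q : α → Bool} (hp : PolyTime p) (hq : PolyTime q) :
    PolyTime fun a => p a && q a := by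
  have : PolyTime fun a => bif p a then q a else false := by fun_prop
  simpa using this

@[fun_prop]
theorem filter {l : α → List β} {p : α → β → Bool} (hl : PolyTime l)
    (hp : PolyTime fun q : α × β => p q.1 q.2) : PolyTime fun a => (l a).filter (p a) := by
  have h : PolyTime fun a => (l a).flatMap fun b => bif p a b then [b] else [] := by fun_prop
  have key : ∀ (l : List β) (p : β → Bool), l.filter p = l.flatMap fun b => bif p b then [b] else [] := by
    intro l p
    induction l with
    | nil => rfl
    | cons b l ih => cases h : p b <;> simp [h, ih]
  simpa only [key] using h

@[fun_prop]
theorem isEmpty {l : α → List β} (hl : PolyTime l) : PolyTime fun a => (l a).isEmpty := by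
  have h : PolyTime fun a => (l a).caseList true fun _ _ => false := by fun_prop
  exact h.congr fun a => by cases l a <;> rfl

@[fun_prop]
theorem tail {l : α → List β} (hl : PolyTime l) : PolyTime fun a => (l a).tail := by
  have h : PolyTime fun a => (l a).caseList [] fun _ t => t := by fun_prop
  exact h.congr fun a => by cases l a <;> rfl

@[fun_prop]
theorem headD {l : α → List β} {f : α → β} (hl : PolyTime l) (hf : PolyTime f) :
    PolyTime fun a => (l a).headD (f a) := by
  have h : PolyTime fun a => (l a).caseList (f a) fun b _ => b := by fun_prop
  exact h.congr fun a => by cases l a <;> rfl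

@[fun_prop]
theorem all {l : α → List β} {p : α → β → Bool} (hl : PolyTime l)
    (hp : PolyTime fun q : α × β => p q.1 q.2) : PolyTime fun a => (l a).all (p a) := by
  have h : PolyTime fun a => ((l a).filter fun b => !p a b).isEmpty := by fun_prop
  refine h.congr fun a => ?_
  rw [Bool.eq_iff_iff]
  simp [List.isEmpty_iff, List.filter_eq_nil_iff]

@[fun_prop]
theorem any {l : α → List β} {p : α → β → Bool} (hl : PolyTime l)
    (hp : PolyTime fun q : α × β => p q.1 q.2) : PolyTime fun a => (l a).any (p a) := by
  have h : PolyTime fun a => !(l a).all fun b => !p a b := by fun_prop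
  refine h.congr fun a => ?_
  simp [List.not_all_eq_any_not]

@[fun_prop]
theorem zip {l : α → List β} {l' : α → List γ} (hl : PolyTime l) (hl' : PolyTime l') :
    PolyTime fun a => (l a).zip (l' a) := by
  have h : PolyTime fun a => ((l a).foldl (fun (s : List γ × List (β × γ)) b =>
      s.1.caseList ([], s.2) fun c t => (t, (b, c) :: s.2)) (l' a, [])).2.reverse := by
    refine reverse (snd (foldl_of_le_add hl (by fun_prop) (by fun_prop)
      (hl.polyBound.add (.const 2)) ?_))
    rintro a b hb ⟨_ | ⟨c, t⟩, s⟩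
    · simp
    · have := csize_le_of_mem hb
      simp; omega
  have key : ∀ (l : List β) (l' : List γ) (s : List (β × γ)),
      (l.foldl (fun (s : List γ × List (β × γ)) b =>
        s.1.caseList ([], s.2) fun c t => (t, (b, c) :: s.2)) (l', s)).2 =
      (l.zip l').reverse ++ s := by
    intro l
    induction l with
    | nil => simp
    | cons b l ih =>
      rintro (_ | ⟨c, l'⟩) s
      · simp [ih]
      · simp [ih]
  simpa only [key, List.append_nil, List.reverse_reverse] using h

@[fun_prop]
theorem option_some {f : α → β} (hf : PolyTime f) : PolyTime fun a => Option.some (f a) :=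
  (of_code_eq (f := fun p : β × Unit => Option.some p.1) fun _ => rfl).comp (hf.prodMk (const ()))

theorem toList {f : α → Option β} (hf : PolyTime f) : PolyTime fun a => (f a).toList :=
  (of_code_eq (f := fun o : Option β => o.toList) fun _ => rfl).comp hf

/-- Case distinction on an optional value, as a function to which `fun_prop` applies. -/
def _root_.Option.caseOption {α β : Type} (o : Option α) (z : β) (s : α → β) : β :=
  match o with
  | none => z
  | Option.some a => s a

@[simp]
theorem _root_.Option.caseOption_none {α β : Type} (z : β) (s : α → β) :
    none.caseOption z s = z := rfl

@[simp]
theorem _root_.Option.caseOption_some {α β : Type} (a : α) (z : β) (s : α → β) :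
    (Option.some a).caseOption z s = s a := rfl

@[fun_prop]
theorem caseOption {o : α → Option β} {z : α → γ} {s : α → β → γ} (ho : PolyTime o)
    (hz : PolyTime z) (hs : PolyTime fun p : α × β => s p.1 p.2) :
    PolyTime fun a => (o a).caseOption (z a) (s a) := by
  have h := caseList (s := fun a b _ => s a b) (toList ho) hz (by fun_prop)
  exact h.congr fun a => by cases o a <;> rfl

/-! Unary numbers are lists of units, so that their arithmetic reduces to list operations. -/

theorem replicate_unit {n : α → ℕ} (hn : PolyTime n) : PolyTime fun a => List.replicate (n a) () :=
  (of_code_eq (f := fun n => List.replicate n ()) fun _ => rfl).comp hn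

@[fun_prop]
theorem length {l : α → List β} (hl : PolyTime l) : PolyTime fun a => (l a).length := by
  have h : PolyTime fun a => ((l a).map fun _ => ()).length :=
    (of_code_eq (f := fun l : List Unit => l.length) fun l => (congrArg code
      (List.eq_replicate_length.2 fun _ _ => rfl).symm :
        code (List.replicate l.length ()) = code l)).comp (by fun_prop)
  simpa using h

section arithmetic
variable {m n : α → ℕ} (hm : PolyTime m) (hn : PolyTime n)
include hm hn

@[fun_prop]
theorem add : PolyTime fun a => m a + n a := by
  have hm' := replicate_unit hm
  have hn' := replicate_unit hn
  have h : PolyTime fun a => (List.replicate (m a) () ++ List.replicate (n a) ()).length := by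
    fun_prop
  simpa using h

@[fun_prop]
theorem mul : PolyTime fun a => m a * n a := by
  have hm' := replicate_unit hm
  have hn' := replicate_unit hn
  have h : PolyTime fun a =>
      ((List.replicate (m a) ()).flatMap fun _ => List.replicate (n a) ()).length :=
    length (flatMap hm' (hn'.comp (g := fun p : α × Unit => p.1) fst'))
  simpa using h

@[fun_prop]
theorem sub : PolyTime fun a => m a - n a := by
  have hm' := replicate_unit hm
  have hn' := replicate_unit hn
  have h : PolyTime fun a => ((List.replicate (n a) ()).foldl (fun s _ => s.tail)
      (List.replicate (m a) ())).length :=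
    length (foldl_of_le_add (by fun_prop) (by fun_prop) (by fun_prop) (.const 0)
      fun a b hb s => csize_sublist (List.tail_sublist s))
  refine h.congr fun a => ?_
  generalize m a = i
  generalize n a = j
  induction j generalizing i with
  | zero => simp
  | succ j ih =>
    rw [List.replicate_succ, List.foldl_cons, List.tail_replicate, ← ih]
    omega

@[fun_prop]
theorem decide_le : PolyTime fun a => decide (m a ≤ n a) := by
  have h : PolyTime fun a => (List.replicate (m a - n a) ()).isEmpty :=
    isEmpty (replicate_unit (by fun_prop))
  refine h.congr fun a => ?_
  rw [Bool.eq_iff_iff]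
  simp [Nat.sub_eq_zero_iff_le]

@[fun_prop]
theorem decide_lt : PolyTime fun a => decide (m a < n a) := by
  have h : PolyTime fun a => decide (m a + 1 ≤ n a) := by fun_prop
  exact h

@[fun_prop]
theorem decide_nat_eq : PolyTime fun a => decide (m a = n a) := by
  have h : PolyTime fun a => decide (m a ≤ n a) && decide (n a ≤ m a) := by fun_prop
  refine h.congr fun a => ?_
  rw [Bool.eq_iff_iff]
  simp [Nat.le_antisymm_iff]

/-- Remainders are computed by counting modulo `n`. -/
@[fun_prop]
theorem mod : PolyTime fun a => m a % n a := by
  have h : PolyTime fun a => (List.replicate (m a) ()).foldl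
      (fun r _ => bif decide (r + 1 = n a) then 0 else r + 1) 0 := by
    refine foldl_of_le_add (replicate_unit hm) (by fun_prop) (by fun_prop) (.const 2)
      fun a b hb s => ?_
    cases h : decide (s + 1 = n a) <;> simp only [cond_true, cond_false, csize_nat] <;> omega
  refine h.congr fun a => ?_
  generalize n a = j
  generalize m a = i
  induction i with
  | zero => simp
  | succ i ih =>
    rw [List.replicate_succ', List.foldl_append, ← ih]
    simp only [List.foldl_cons, List.foldl_nil]
    rw [← Nat.mod_add_mod]
    by_cases h : i % j + 1 = j
    · simp [h]
    · simp only [h, decide_false, cond_false]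
      rcases Nat.eq_zero_or_pos j with rfl | hj
      · simp
      · exact Nat.mod_eq_of_lt (by have := Nat.mod_lt i hj; omega)

end arithmetic

@[fun_prop]
theorem range {n : α → ℕ} (hn : PolyTime n) : PolyTime fun a => List.range (n a) := by
  have key : ∀ n, (List.replicate n ()).foldl (fun (s : List ℕ) _ => s ++ [s.length]) [] =
      List.range n := by
    intro n
    induction n with
    | zero => rfl
    | succ n ih => rw [List.replicate_succ', List.foldl_append, ih]; simp [List.range_succ]
  have h : PolyTime fun a => (List.replicate (n a) ()).foldl
      (fun (s : List ℕ) _ => s ++ [s.length]) [] := by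
    refine foldl (b := fun a => csize (n a) * (csize (n a) + 1) + 1) (replicate_unit hn)
      (by fun_prop) (by fun_prop)
      (.add (.mul hn.polyBound (.add hn.polyBound (.const 1))) (.const 1)) fun a l₁ h => ?_
    have hl : l₁.length ≤ n a := by simpa using h.length_le
    rw [(List.eq_replicate_length.2 fun _ _ => rfl : l₁ = List.replicate l₁.length ()), key]
    refine (csize_list_le (B := csize (n a)) fun i hi => ?_).trans ?_
    · have := List.mem_range.1 hi
      simp; omega
    · have : (List.range l₁.length).length ≤ csize (n a) := by simp; omega
      gcongr
  exact h.congr fun a => (key _).symm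

end PolyTime

/-- Types with a polynomial-time equality test. -/
class PolyEq (α : Type) [Code α] [DecidableEq α] : Prop where
  polyTime_eq : PolyTime fun p : α × α => decide (p.1 = p.2)

@[fun_prop]
theorem PolyTime.decide_eq {α β : Type} [Code α] [Code β] [DecidableEq β] [PolyEq β] {f g : α → β}
    (hf : PolyTime f) (hg : PolyTime g) : PolyTime fun a => decide (f a = g a) :=
  PolyEq.polyTime_eq.comp (hf.prodMk hg)

@[fun_prop]
theorem PolyTime.decide_ne {α β : Type} [Code α] [Code β] [DecidableEq β] [PolyEq β] {f g : α → β}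
    [∀ a, Decidable (f a ≠ g a)] (hf : PolyTime f) (hg : PolyTime g) :
    PolyTime fun a => decide (f a ≠ g a) := by
  have h : PolyTime fun a => !decide (f a = g a) := by fun_prop
  refine h.congr fun a => ?_
  rw [Bool.eq_iff_iff]
  simp

instance : PolyEq ℕ := ⟨by fun_prop⟩

instance : PolyEq Bool := ⟨by
  have h : PolyTime fun p : Bool × Bool => bif p.1 then p.2 else !p.2 := by fun_prop
  refine h.congr ?_
  decide⟩

section
variable {α β : Type} [Code α] [Code β] [DecidableEq α] [DecidableEq β] [PolyEq α] [PolyEq β]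

instance : PolyEq (α × β) := ⟨by
  have h : PolyTime fun p : (α × β) × (α × β) => decide (p.1.1 = p.2.1) && decide (p.1.2 = p.2.2) := by
    fun_prop
  refine h.congr fun p => ?_
  rw [Bool.eq_iff_iff]
  simp [Prod.ext_iff]⟩

instance : PolyEq (List α) := ⟨by
  have h : PolyTime fun p : List α × List α => decide (p.1.length = p.2.length) &&
      (p.1.zip p.2).all fun q => decide (q.1 = q.2) := by
    fun_prop
  refine h.congr fun p => ?_
  rw [Bool.eq_iff_iff]
  obtain ⟨l, l'⟩ := p
  simp only [decide_eq_true_eq, Bool.and_eq_true, List.all_eq_true]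
  constructor
  · rintro rfl
    simp [List.zip_eq_zipWith, List.zipWith_self]
  · rintro ⟨h₁, h₂⟩
    refine List.ext_getElem h₁ fun i hi hi' => ?_
    exact h₂ (l[i], l'[i]) (List.mem_iff_getElem.2 ⟨i, by simp [hi, hi'], by simp⟩)⟩

end

namespace PolyTime
variable {α β : Type} [Code α] [Code β]

@[fun_prop]
theorem decide_mem [DecidableEq β] [PolyEq β] {f : α → β} {l : α → List β}
    [∀ a, Decidable (f a ∈ l a)] (hf : PolyTime f) (hl : PolyTime l) : PolyTime fun a => decide (f a ∈ l a) := by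
  have h : PolyTime fun a => (l a).any fun b => decide (f a = b) := by fun_prop
  refine h.congr fun a => ?_
  rw [Bool.eq_iff_iff]
  simp

@[fun_prop]
theorem decide_pairwise {l : α → List β} {r : α → β → β → Prop}
    [∀ a, DecidableRel (r a)] (hl : PolyTime l)
    (hr : PolyTime fun p : α × β × β => decide (r p.1 p.2.1 p.2.2)) :
    PolyTime fun a => decide ((l a).Pairwise (r a)) := by
  have h : PolyTime fun a => ((l a).foldl (fun (s : Bool × List β) b =>
      (s.1 && s.2.all fun c => decide (r a c b), b :: s.2)) (true, [])).1 := by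
    refine fst (foldl_of_le_add hl (by fun_prop) ?_ (hl.polyBound.add (.const 3)) ?_)
    · have hr' : PolyTime fun p : (α × (Bool × List β) × β) × β => decide (r p.1.1 p.2 p.1.2.2) :=
        hr.comp (g := fun p : (α × (Bool × List β) × β) × β => (p.1.1, p.2, p.1.2.2)) (by fun_prop)
      fun_prop
    · rintro a b hb ⟨s, t⟩
      have h1 := csize_le_of_mem hb
      have h2 := csize_bool_le (s && t.all fun c => decide (r a c b))
      have h3 := csize_pos s
      simp only [csize_prod, csize_cons]
      omega
  refine h.congr fun a => ?_
  have key : ∀ (l : List β) (s : Bool) (t : List β),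
      (l.foldl (fun (s : Bool × List β) b =>
        (s.1 && s.2.all fun c => decide (r a c b), b :: s.2)) (s, t)).1 =
      (s && decide (l.Pairwise (r a)) && l.all fun b => t.all fun c => decide (r a c b)) := by
    intro l
    induction l with
    | nil => simp
    | cons b l ih =>
      intro s t
      rw [List.foldl_cons, ih, Bool.eq_iff_iff]
      simp only [Bool.and_eq_true, List.all_eq_true, decide_eq_true_eq, List.pairwise_cons,
        List.mem_cons, forall_eq_or_imp]
      constructor
      · rintro ⟨⟨⟨h1, h2⟩, h3⟩, h4⟩
        exact ⟨⟨h1, fun c hc => (h4 c hc).1, h3⟩, h2, fun c hc => (h4 c hc).2⟩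
      · rintro ⟨⟨h1, h2, h3⟩, h4, h5⟩
        exact ⟨⟨⟨h1, h4⟩, h3⟩, fun c hc => ⟨h2 c hc, h5 c hc⟩⟩
  rw [key]
  simp

end PolyTime

/-! ### Polynomial-time decoding of self-delimiting encodings -/

/-- The polynomial-time function `d` recognizes the codewords of `e` at the beginning of a word and
reads them off. -/
structure IsDecoder {α : Type} [Code α] (e : α → List Bool)
    (d : List Bool → Option (α × List Bool)) : Prop where
  polyTime_encode : PolyTime e
  polyTime : PolyTime d
  eq_some_iff : ∀ x a u, d x = some (a, u) ↔ x = e a ++ u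
  csize_le : ∃ K, ∀ a, csize a ≤ K * ((e a).length + 1)

/-- Decoder for single bits. -/
def decodeBit (x : List Bool) : Option (Bool × List Bool) :=
  x.caseList none fun b t => some (b, t)

theorem isDecoder_decodeBit : IsDecoder (fun b => [b]) decodeBit where
  polyTime_encode := by fun_prop
  polyTime := by unfold decodeBit; fun_prop
  eq_some_iff x a u := by cases x <;> simp [decodeBit]
  csize_le := ⟨3, fun a => (csize_bool_le a).trans (by simp)⟩

/-- Decoder for concatenations of two codewords. -/
def decodeProd {α β : Type} (d : List Bool → Option (α × List Bool))
    (d' : List Bool → Option (β × List Bool)) (x : List Bool) : Option ((α × β) × List Bool) :=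
  (d x).caseOption none fun p => (d' p.2).caseOption none fun q => some ((p.1, q.1), q.2)

theorem IsDecoder.prod {α β : Type} [Code α] [Code β] {e : α → List Bool} {e' : β → List Bool}
    {d : List Bool → Option (α × List Bool)} {d' : List Bool → Option (β × List Bool)}
    (h : IsDecoder e d) (h' : IsDecoder e' d') :
    IsDecoder (fun p : α × β => e p.1 ++ e' p.2) (decodeProd d d') where
  polyTime_encode := by
    have := h.polyTime_encode
    have := h'.polyTime_encode
    fun_prop
  polyTime := by
    have := h.polyTime
    have := h'.polyTime
    unfold decodeProd
    fun_prop
  eq_some_iff x p u := by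
    obtain ⟨a, b⟩ := p
    constructor
    · intro hx
      unfold decodeProd at hx
      rcases h1 : d x with _ | ⟨a', v⟩
      · simp [h1] at hx
      rcases h2 : d' v with _ | ⟨b', w⟩
      · simp [h1, h2] at hx
      simp only [h1, h2, Option.caseOption_some, Option.some.injEq, Prod.mk.injEq] at hx
      obtain ⟨⟨rfl, rfl⟩, rfl⟩ := hx
      rw [(h.eq_some_iff _ _ _).1 h1, (h'.eq_some_iff _ _ _).1 h2, List.append_assoc]
    · intro hx
      have h1 := (h.eq_some_iff x a (e' b ++ u)).2 (by rw [hx, List.append_assoc])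
      have h2 := (h'.eq_some_iff _ b u).2 rfl
      simp [decodeProd, h1, h2]
  csize_le := by
    obtain ⟨K, hK⟩ := h.csize_le
    obtain ⟨K', hK'⟩ := h'.csize_le
    refine ⟨K + K' + 1, fun p => ?_⟩
    have h1 := hK p.1
    have h2 := hK' p.2
    simp only [csize_prod, List.length_append]
    nlinarith [Nat.zero_le (K * (e' p.2).length), Nat.zero_le (K' * (e p.1).length)]

/-- One step of `decodeList`. The state consists of a bit that tells whether the end mark has been
read, the entries read so far in reverse order, and the remaining word; it is `none` after a
failure. -/
def decodeListStep {α : Type} (d : List Bool → Option (α × List Bool))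
    (s : Option (Bool × List α × List Bool)) : Option (Bool × List α × List Bool) :=
  s.caseOption none fun s => bif s.1 then some s else
    s.2.2.caseList none fun b t =>
      bif b then (d t).caseOption none fun p => some (false, p.1 :: s.2.1, p.2)
      else some (true, s.2.1, t)

/-- Decoder for lists. The word itself serves as a counter for the number of steps. -/
def decodeList {α : Type} (d : List Bool → Option (α × List Bool)) (x : List Bool) :
    Option (List α × List Bool) :=
  (x.foldl (fun s _ => decodeListStep d s) (some (false, [], x))).caseOption none fun s =>
    bif s.1 then some (s.2.1.reverse, s.2.2) else none

theorem csize_le_flatMap_length {α : Type} [Code α] {e : α → List Bool} {K : ℕ}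
    (hK : ∀ a, csize a ≤ K * ((e a).length + 1)) (l : List α) :
    csize l ≤ (K + 1) * (l.flatMap fun a => true :: e a).length + 1 := by
  induction l with
  | nil => simp
  | cons a l ih =>
    have := hK a
    simp only [csize_cons, List.flatMap_cons, List.length_append, List.length_cons]
    nlinarith

theorem length_lt_length_encodeList {α : Type} (e : α → List Bool) (l : List α) :
    l.length < (encodeList e l).length := by
  induction l with
  | nil => simp [encodeList]
  | cons a l ih =>
    simp only [encodeList, List.flatMap_cons, List.length_append, List.length_cons] at ih ⊢
    omega

section decodeList
variable {α : Type} [Code α] {e : α → List Bool} {d : List Bool → Option (α × List Bool)}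

/-- The entries that have been read and the remaining word make up the input. -/
theorem decodeListStep_invariant (h : IsDecoder e d) (x : List Bool) (w : List Bool) (f : Bool)
    (acc : List α) (u : List Bool)
    (hs : w.foldl (fun s _ => decodeListStep d s) (some (false, [], x)) = some (f, acc, u)) :
    x = (acc.reverse.flatMap fun a => true :: e a) ++ ((if f then [false] else []) ++ u) := by
  induction w using List.reverseRecOn generalizing f acc u with
  | nil =>
    simp only [List.foldl_nil, Option.some.injEq, Prod.mk.injEq] at hs
    obtain ⟨rfl, rfl, rfl⟩ := hs
    simp
  | append_singleton w b ih =>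
    rw [List.foldl_append, List.foldl_cons, List.foldl_nil] at hs
    rcases h1 : w.foldl (fun s _ => decodeListStep d s) (some (false, [], x)) with
      _ | ⟨f', acc', u'⟩
    · rw [h1] at hs
      simp [decodeListStep] at hs
    have ih' := ih _ _ _ h1
    rw [h1] at hs
    cases f' with
    | true =>
      simp only [decodeListStep, Option.caseOption_some, cond_true, Option.some.injEq,
        Prod.mk.injEq] at hs
      obtain ⟨rfl, rfl, rfl⟩ := hs
      exact ih'
    | false =>
      rcases u' with _ | ⟨_ | _, u'⟩
      · simp [decodeListStep] at hs
      · simp only [decodeListStep, Option.caseOption_some, cond_false, List.caseList_cons,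
          Option.some.injEq, Prod.mk.injEq] at hs
        obtain ⟨rfl, rfl, rfl⟩ := hs
        simpa using ih'
      · rcases h2 : d u' with _ | ⟨a, v⟩
        · simp [decodeListStep, h2] at hs
        simp only [decodeListStep, Option.caseOption_some, cond_false, List.caseList_cons, cond_true,
          h2, Option.some.injEq, Prod.mk.injEq] at hs
        obtain ⟨rfl, rfl, rfl⟩ := hs
        rw [ih', (h.eq_some_iff _ _ _).1 h2]
        simp

/-- On a word that starts with the codeword of `l`, more than `l.length` steps read off `l`. -/
theorem foldl_decodeListStep (h : IsDecoder e d) (l : List α) (u w : List Bool) (acc : List α)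
    (hw : l.length < w.length) :
    w.foldl (fun s _ => decodeListStep d s) (some (false, acc, encodeList e l ++ u)) =
      some (true, l.reverse ++ acc, u) := by
  induction l generalizing w acc with
  | nil =>
    rcases w with _ | ⟨b, w⟩
    · simp at hw
    simp only [List.foldl_cons, encodeList, List.flatMap_nil, List.nil_append, List.cons_append,
      decodeListStep, Option.caseOption_some, cond_false, List.caseList_cons, List.reverse_nil]
    clear hw
    induction w with
    | nil => rfl
    | cons b w ih => simpa using ih
  | cons a l ih =>
    rcases w with _ | ⟨b, w⟩
    · simp at hw
    have h1 : encodeList e (a :: l) ++ u = true :: (e a ++ (encodeList e l ++ u)) := by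
      simp [encodeList]
    have h2 := (h.eq_some_iff _ a (encodeList e l ++ u)).2 rfl
    simp only [h1, List.foldl_cons, decodeListStep, Option.caseOption_some, cond_false, cond_true,
      List.caseList_cons, h2]
    have h3 := ih w (a :: acc) (by simpa using hw)
    simp only [decodeListStep] at h3
    rw [h3]
    simp

theorem IsDecoder.list (h : IsDecoder e d) : IsDecoder (encodeList e) (decodeList d) where
  polyTime_encode := by
    have := h.polyTime_encode
    unfold encodeList
    fun_prop
  polyTime := by
    have hd := h.polyTime
    obtain ⟨K, hK⟩ := h.csize_le
    have hf : PolyTime fun x : List Bool =>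
        x.foldl (fun s _ => decodeListStep d s) (some (false, [], x)) := by
      refine PolyTime.foldl (b := fun x => (K + 1) * csize x + csize x + 8) (by fun_prop)
        (by fun_prop) (by unfold decodeListStep; fun_prop)
        (.add (.add (.mul (.const _) .csize) .csize) (.const _)) fun x w _ => ?_
      rcases h1 : w.foldl (fun s _ => decodeListStep d s) (some (false, [], x)) with
        _ | ⟨f, acc, u⟩
      · simp
      have h2 := decodeListStep_invariant h x w f acc u h1
      have h3 := csize_le_flatMap_length hK acc.reverse
      have h4 : csize u ≤ csize x := csize_sublist (by
        rw [h2, ← List.append_assoc]; exact List.sublist_append_right _ _)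
      have h5 : (acc.reverse.flatMap fun a => true :: e a).length ≤ csize x := by
        have := length_lt_csize x
        have := congrArg List.length h2
        simp only [List.length_append] at this
        omega
      have h6 := Nat.mul_le_mul_left (K + 1) h5
      have := csize_bool_le f
      rw [csize_reverse] at h3
      simp only [csize_some, csize_prod]
      omega
    unfold decodeList
    fun_prop
  eq_some_iff x l u := by
    constructor
    · intro hx
      unfold decodeList at hx
      rcases h1 : x.foldl (fun s _ => decodeListStep d s) (some (false, [], x)) with
        _ | ⟨_ | _, acc, v⟩
      · simp [h1] at hx
      · simp [h1] at hx
      · simp only [h1, Option.caseOption_some, cond_true, Option.some.injEq, Prod.mk.injEq] at hx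
        obtain ⟨rfl, rfl⟩ := hx
        rw [decodeListStep_invariant h x x _ _ _ h1]
        simp [encodeList]
    · rintro rfl
      have h1 := foldl_decodeListStep h l u (encodeList e l ++ u) [] (by
        have := length_lt_length_encodeList e l
        rw [List.length_append]
        omega)
      simp [decodeList, h1]
  csize_le := by
    obtain ⟨K, hK⟩ := h.csize_le
    refine ⟨K + 1, fun l => (csize_le_flatMap_length hK l).trans ?_⟩
    simp only [encodeList, List.length_append, List.length_cons, List.length_nil]
    nlinarith

end decodeList

/-! ### Instances as raw data -/

/-- The raw data of a clause: its literals, given by the binary expansion of the index of the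
variable and the sign, and the binary expansions of its allowed values. -/
abbrev RawClause : Type := List (List Bool × Bool) × List (List Bool)

/-- Self-delimiting encoding of a binary expansion. -/
abbrev encodeBits : List Bool → List Bool := encodeList fun b => [b]

/-- Encoding of a raw clause. -/
def RawClause.encode (c : RawClause) : List Bool :=
  encodeList (fun l : List Bool × Bool => encodeBits l.1 ++ [l.2]) c.1 ++ encodeList encodeBits c.2

/-- Decoder for lists of raw clauses. -/
def decodeRaw : List Bool → Option (List RawClause × List Bool) :=
  decodeList (decodeProd (decodeList (decodeProd (decodeList decodeBit) decodeBit))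
    (decodeList (decodeList decodeBit)))

theorem isDecoder_decodeRaw : IsDecoder (encodeList RawClause.encode) decodeRaw :=
  (((isDecoder_decodeBit.list.prod isDecoder_decodeBit).list).prod isDecoder_decodeBit.list.list).list

/-- The raw data of a clause. -/
def ConstrainedClause.raw {d n : ℕ} (c : ConstrainedClause d n) : RawClause :=
  (c.literals.map fun l => ((l.1 : ℕ).bits, l.2), c.allowed.map Nat.bits)

theorem encodeList_map {α β : Type} (e : β → List Bool) (f : α → β) (l : List α) :
    encodeList e (l.map f) = encodeList (fun a => e (f a)) l := by
  simp [encodeList, List.flatMap_map]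

theorem ConstrainedClause.encode_raw {d n : ℕ} (c : ConstrainedClause d n) :
    c.raw.encode = c.encode := by
  simp only [RawClause.encode, raw, encodeList_map, ConstrainedClause.encode]
  rfl

theorem GenSatInstance.encode_eq {d n : ℕ} (I : GenSatInstance d n) :
    I.encode = encodeList RawClause.encode (I.clauses.map ConstrainedClause.raw) := by
  rw [encodeList_map]
  simp only [ConstrainedClause.encode_raw]
  rfl

/-! ### The kernelization algorithm -/

/-- The successor on binary expansions, least significant bit first. -/
def incBits : List Bool → List Bool
  | [] => [true]
  | false :: l => true :: l
  | true :: l => false :: incBits l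

theorem incBits_bits (n : ℕ) : incBits n.bits = (n + 1).bits := by
  induction n using Nat.binaryRec' with
  | zero => simp [incBits]
  | bit b n hn ih =>
    rw [Nat.bits_append_bit n b hn]
    cases b with
    | false =>
      rw [show Nat.bit false n + 1 = Nat.bit true n by simp [Nat.bit]]
      rw [Nat.bits_append_bit n true (by simp)]
      rfl
    | true =>
      rw [show Nat.bit true n + 1 = Nat.bit false (n + 1) by simp [Nat.bit]; ring]
      rw [Nat.bits_append_bit (n + 1) false (by simp), ← ih]
      rfl

theorem bits_injective : Function.Injective Nat.bits := by
  intro a b h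
  exact (selfDelimiting_encodeNat a b [] [] (by simp [encodeNat, h])).1

namespace PolyTime
variable {α : Type} [Code α]

@[fun_prop]
theorem incBits {l : α → List Bool} (hl : PolyTime l) : PolyTime fun a => incBits (l a) := by
  suffices h : PolyTime _root_.incBits from h.comp hl
  have h : PolyTime fun l : List Bool => (fun s : Bool × List Bool =>
      bif s.1 then (true :: s.2).reverse else s.2.reverse) (l.foldl (fun (s : Bool × List Bool) b =>
        (s.1 && b, (bif s.1 then !b else b) :: s.2)) (true, [])) := by
    refine PolyTime.comp (f := fun s : Bool × List Bool =>
      bif s.1 then (true :: s.2).reverse else s.2.reverse) (by fun_prop)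
      (foldl_of_le_add (t := fun _ => 7) (by fun_prop) (by fun_prop) (by fun_prop) (.const _) ?_)
    rintro a b hb ⟨c, acc⟩
    have := csize_bool_le (c && b)
    have := csize_bool_le (bif c then !b else b)
    simp only [csize_prod, csize_cons]
    omega
  refine h.congr fun l => ?_
  have key : ∀ (l : List Bool) (c : Bool) (acc : List Bool), (fun s : Bool × List Bool =>
      bif s.1 then (true :: s.2).reverse else s.2.reverse) (l.foldl (fun (s : Bool × List Bool) b =>
        (s.1 && b, (bif s.1 then !b else b) :: s.2)) (c, acc)) =
      acc.reverse ++ bif c then _root_.incBits l else l := by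
    intro l
    induction l with
    | nil => intro c acc; cases c <;> simp [_root_.incBits]
    | cons b l ih =>
      intro c acc
      rw [List.foldl_cons, ih]
      cases c <;> cases b <;> simp [_root_.incBits]
  rw [key]
  simp

@[fun_prop]
theorem bits {n : α → ℕ} (hn : PolyTime n) : PolyTime fun a => (n a).bits := by
  have h : PolyTime fun a => (List.replicate (n a) ()).foldl (fun s _ => _root_.incBits s) [] := by
    refine foldl_of_le_add (t := fun _ => 10) (replicate_unit hn) (by fun_prop) (by fun_prop)
      (.const _) fun a _ _ s => ?_
    induction s with
    | nil => decide
    | cons b s ih =>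
      cases b
      · simp only [_root_.incBits, csize_cons]
        have := csize_bool_le true
        omega
      · simp only [_root_.incBits, csize_cons]
        have := csize_bool_le false
        have : csize false ≤ csize true := by decide
        omega
  refine h.congr fun a => ?_
  induction n a with
  | zero => simp
  | succ i ih => rw [List.replicate_succ', List.foldl_append, ← ih]; simp [incBits_bits]

end PolyTime

/-- The names of the first `n` variables. -/
def varNames (n : ℕ) : List (List Bool) :=
  (List.range n).map Nat.bits

/-- All `d`-tuples of the first `n` variables. -/
def varTuples (n : ℕ) : ℕ → List (List (List Bool))
  | 0 => [[]]
  | d + 1 => (varTuples n d).flatMap fun t => (varNames n).map fun v => v :: t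

/-- A list of `n ^ d + 1` sets of variables, with repetitions, among which are all sets of at most
`d` of the first `n` variables. A set of variables stands for the assignment that makes exactly these variables true. -/
def testPoints (d n : ℕ) : List (List (List Bool)) :=
  [] :: varTuples n d

/-- The number of literals of `c` satisfied by the assignment that makes exactly the variables
in `t` true. -/
def satCount (c : RawClause) (t : List (List Bool)) : ℕ :=
  (c.1.filter fun l => decide (decide (l.1 ∈ t) = l.2)).length

/-- The allowed values of `c` that are less than `q`. -/
def smallAllowed (q : ℕ) (c : RawClause) : List ℕ :=
  (List.range q).filter fun s => decide (s.bits ∈ c.2)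

/-- The value modulo `q` of the polynomial of the clause `c` at `t`: the product of the
`satCount c t - s` over the allowed values `s < q`. -/
def clauseValue (q : ℕ) (c : RawClause) (t : List (List Bool)) : ℕ :=
  (smallAllowed q c).foldl (fun v s => v * (satCount c t + (q - s)) % q) 1

/-- Remove the allowed values that are not less than `q`. -/
def cutAllowed (q : ℕ) (c : RawClause) : RawClause :=
  (c.1, c.2.filter fun b => decide (b ∈ varNames q))

/-- The vector `a * v - b * w` modulo `q`. -/
def combineRows (q a b : ℕ) (v w : List ℕ) : List ℕ :=
  (v.zip w).map fun x => (a * x.1 + (q - b % q) * x.2) % q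

/-- Elimination of the first column. The state consists of rows labelled by clauses and of the
clauses chosen so far. If some row has a nonzero entry in the first column, its clause is chosen,
and multiples of this row are subtracted from the others. The first column is removed. -/
def elimStep (q : ℕ) (s : List (RawClause × List ℕ) × List RawClause) :
    List (RawClause × List ℕ) × List RawClause :=
  (s.1.filter fun r => !decide (r.2.headD 0 = 0)).caseList
    (s.1.map fun r => (r.1, r.2.tail), s.2) fun p _ =>
      (s.1.map fun r => (r.1, combineRows q (p.2.headD 0) (r.2.headD 0) r.2.tail p.2.tail),
        p.1 :: s.2)

/-- The clauses chosen when the columns indexed by `ts` are eliminated one after the other. -/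
def chosenClauses (q : ℕ) (ts : List (List (List Bool))) (rows : List (RawClause × List ℕ)) :
    List RawClause :=
  (ts.foldl (fun s _ => elimStep q s) (rows, [])).2

/-- The matrix of the values of the clause polynomials at the points `ts`. -/
def valueRows (q : ℕ) (ts : List (List (List Bool))) (cs : List RawClause) :
    List (RawClause × List ℕ) :=
  cs.map fun c => (c, ts.map fun t => clauseValue q c t)

/-- The clauses that remain: their polynomials span those of all clauses. -/
def sparsify (d q n : ℕ) (cs : List RawClause) : List RawClause :=
  (cs.map fun c => cutAllowed q c).filter fun c => decide (c ∈ chosenClauses q (testPoints d n)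
    (valueRows q (testPoints d n) (cs.map fun c => cutAllowed q c)))

/-- Test for raw data of clauses. The last bit of a binary expansion is not `0`. -/
def validClause (d n : ℕ) (c : RawClause) : Bool :=
  decide (c.1.Pairwise (· ≠ ·)) && c.1.all (fun l => decide (l.1 ∈ varNames n)) &&
    decide (c.2.Pairwise (· ≠ ·)) && c.2.all (fun b => b.reverse.headD true) &&
    decide (c.2.length ≤ d)

/-- Test whether two lists have the same elements. -/
def sameElements {α : Type} [DecidableEq α] (l l' : List α) : Bool :=
  l.all (fun a => decide (a ∈ l')) && l'.all fun a => decide (a ∈ l)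

/-- Test for raw data of instances. -/
def validRaw (d n : ℕ) (cs : List RawClause) : Bool :=
  cs.all (fun c => validClause d n c) && decide (cs.Pairwise fun c c' => sameElements c.1 c'.1 = false)

/-- The kernelization, with modulus `q n` for parameter `n`. Invalid words are mapped to the
instance with one empty clause without allowed values, which is unsatisfiable. -/
def kernelWord (d : ℕ) (q : ℕ → ℕ) (x : List Bool) (n : ℕ) : List Bool :=
  (decodeRaw x).caseOption (encodeList RawClause.encode [([], [])]) fun p =>
    bif p.2.isEmpty && validRaw d n p.1 then
      encodeList RawClause.encode (sparsify d (q n) n p.1)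
    else encodeList RawClause.encode [([], [])]

/-! ### The entries of the matrix take polynomial time -/

namespace PolyTime
variable {α : Type} [Code α]

@[fun_prop]
theorem varNames {n : α → ℕ} (hn : PolyTime n) : PolyTime fun a => varNames (n a) := by
  unfold _root_.varNames
  fun_prop

@[fun_prop]
theorem varTuples {n : α → ℕ} (hn : PolyTime n) (d : ℕ) : PolyTime fun a => varTuples (n a) d := by
  induction d with
  | zero => simp only [_root_.varTuples]; fun_prop
  | succ d ih => simp only [_root_.varTuples]; fun_prop

@[fun_prop]
theorem testPoints {n : α → ℕ} (hn : PolyTime n) (d : ℕ) :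
    PolyTime fun a => testPoints d (n a) := by
  unfold _root_.testPoints
  fun_prop

@[fun_prop]
theorem satCount {c : α → RawClause} {t : α → List (List Bool)} (hc : PolyTime c)
    (ht : PolyTime t) : PolyTime fun a => satCount (c a) (t a) := by
  unfold _root_.satCount
  fun_prop

@[fun_prop]
theorem smallAllowed {c : α → RawClause} {q : α → ℕ} (hq : PolyTime q) (hc : PolyTime c) :
    PolyTime fun a => smallAllowed (q a) (c a) := by
  unfold _root_.smallAllowed
  fun_prop

@[fun_prop]
theorem cutAllowed {c : α → RawClause} {q : α → ℕ} (hq : PolyTime q) (hc : PolyTime c) :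
    PolyTime fun a => cutAllowed (q a) (c a) := by
  unfold _root_.cutAllowed
  fun_prop

@[fun_prop]
theorem combineRows {q x y : α → ℕ} {v w : α → List ℕ} (hq : PolyTime q) (hx : PolyTime x)
    (hy : PolyTime y) (hv : PolyTime v) (hw : PolyTime w) :
    PolyTime fun a => combineRows (q a) (x a) (y a) (v a) (w a) := by
  unfold _root_.combineRows
  fun_prop

@[fun_prop]
theorem elimStep {q : α → ℕ} {s : α → List (RawClause × List ℕ) × List RawClause}
    (hq : PolyTime q) (hs : PolyTime s) : PolyTime fun a => elimStep (q a) (s a) := by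
  unfold _root_.elimStep
  fun_prop

end PolyTime

/-! ### The elimination and the kernelization take polynomial time -/

/-- There are at most `L` rows with at most `N` entries each, all at most `Q`, and every label and
every chosen clause has size at most `Z`. -/
structure ElimBound (L N Q Z : ℕ) (s : List (RawClause × List ℕ) × List RawClause) : Prop where
  length_rows : s.1.length ≤ L
  label : ∀ r ∈ s.1, csize r.1 ≤ Z
  length_row : ∀ r ∈ s.1, r.2.length ≤ N
  entry : ∀ r ∈ s.1, ∀ x ∈ r.2, x ≤ Q
  chosen : ∀ c ∈ s.2, csize c ≤ Z

/-- Either the first column is zero and is removed, or some row `p` serves as the pivot. -/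
theorem elimStep_eq (q : ℕ) (s : List (RawClause × List ℕ) × List RawClause) :
    ((∀ r ∈ s.1, r.2.headD 0 = 0) ∧ elimStep q s = (s.1.map fun r => (r.1, r.2.tail), s.2)) ∨
    ∃ p ∈ s.1, p.2.headD 0 ≠ 0 ∧ elimStep q s = (s.1.map fun r =>
      (r.1, combineRows q (p.2.headD 0) (r.2.headD 0) r.2.tail p.2.tail), p.1 :: s.2) := by
  unfold elimStep
  generalize h : (s.1.filter fun r => !decide (r.2.headD 0 = 0)) = l'
  rcases l' with _ | ⟨p, l⟩
  · left
    have h' := List.filter_eq_nil_iff.1 h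
    exact ⟨fun r hr => by simpa using h' r hr, by rw [List.caseList_nil]⟩
  · right
    have hp : p ∈ s.1.filter fun r => !decide (r.2.headD 0 = 0) := by rw [h]; simp
    rw [List.mem_filter] at hp
    exact ⟨p, hp.1, by simpa using hp.2, by rw [List.caseList_cons]⟩

theorem length_foldl_elimStep_le (q : ℕ) {β : Type} (l : List β)
    (s : List (RawClause × List ℕ) × List RawClause) :
    (l.foldl (fun s _ => elimStep q s) s).2.length ≤ s.2.length + l.length := by
  induction l generalizing s with
  | nil => simp
  | cons b l ih =>
    have h := ih (elimStep q s)
    rw [List.foldl_cons, List.length_cons]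
    rcases elimStep_eq q s with ⟨-, he⟩ | ⟨p, -, -, he⟩ <;> rw [he] at h ⊢ <;>
      simp only [List.length_cons] at h <;> omega

theorem ElimBound.step {L N Q Z q : ℕ} {s : List (RawClause × List ℕ) × List RawClause}
    (hq : 0 < q) (hQ : q ≤ Q) (h : ElimBound L N Q Z s) :
    ElimBound L N Q Z (elimStep q s) := by
  rcases elimStep_eq q s with ⟨-, he⟩ | ⟨p, hp, -, he⟩ <;> rw [he]
  · refine ⟨by simpa using h.length_rows, ?_, ?_, ?_, h.chosen⟩
    · simpa only [List.forall_mem_map] using h.label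
    · simp only [List.forall_mem_map]
      intro r hr
      have := h.length_row r hr
      simp; omega
    · simp only [List.forall_mem_map]
      exact fun r hr x hx => h.entry r hr x (List.mem_of_mem_tail hx)
  · refine ⟨by simpa using h.length_rows, ?_, ?_, ?_, ?_⟩
    · simpa only [List.forall_mem_map] using h.label
    · simp only [List.forall_mem_map]
      intro r hr
      have := h.length_row r hr
      simp [combineRows]; omega
    · simp only [List.forall_mem_map, combineRows]
      intro r hr y hy
      exact (Nat.mod_lt _ hq).le.trans hQ
    · exact List.forall_mem_cons.2 ⟨h.label p hp, h.chosen⟩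

theorem ElimBound.csize_le {L N Q Z k : ℕ} {s : List (RawClause × List ℕ) × List RawClause}
    (h : ElimBound L N Q Z s)
    (hk : s.2.length ≤ k) :
    csize s ≤ L * (Z + (N * (2 * Q + 1 + 1) + 1) + 1 + 1) + 1 + (k * (Z + 1) + 1) + 1 := by
  have h1 : csize s.1 ≤ s.1.length * (Z + (N * (2 * Q + 1 + 1) + 1) + 1 + 1) + 1 := by
    refine csize_list_le fun r hr => ?_
    have h2 := h.label r hr
    have h3 : csize r.2 ≤ r.2.length * (2 * Q + 1 + 1) + 1 := csize_list_le fun x hx => by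
      have := h.entry r hr x hx
      simp; omega
    have h4 := Nat.mul_le_mul_right (2 * Q + 1 + 1) (h.length_row r hr)
    simp only [csize_prod]
    simp only [csize_prod] at h2
    omega
  have h5 : csize s.2 ≤ s.2.length * (Z + 1) + 1 := csize_list_le h.chosen
  have h6 := Nat.mul_le_mul_right (Z + (N * (2 * Q + 1 + 1) + 1) + 1 + 1) h.length_rows
  have h7 := Nat.mul_le_mul_right (Z + 1) hk
  rw [csize_prod]
  omega

theorem foldl_elimStep_bound {L N Q Z q : ℕ} (hq : 0 < q) (hQ : q ≤ Q) {β : Type} (l : List β)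
    {s : List (RawClause × List ℕ) × List RawClause} (h : ElimBound L N Q Z s) :
    ElimBound L N Q Z (l.foldl (fun s _ => elimStep q s) s) := by
  induction l generalizing s with
  | nil => exact h
  | cons b l ih => exact ih (h.step hq hQ)

namespace PolyTime
variable {α : Type} [Code α]

@[fun_prop]
theorem clauseValue {q : α → ℕ} {c : α → RawClause} {t : α → List (List Bool)}
    (hq : PolyTime q) (hc : PolyTime c) (ht : PolyTime t) :
    PolyTime fun a => clauseValue (q a) (c a) (t a) := by
  unfold _root_.clauseValue
  refine foldl (b := fun a => csize (q a) + 2) (by fun_prop) (by fun_prop) (by fun_prop)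
    (hq.polyBound.add (.const _)) fun a l₁ h => ?_
  rcases l₁.eq_nil_or_concat with rfl | ⟨l, s, rfl⟩
  · simp
  rw [List.concat_eq_append] at h ⊢
  have hs : s < q a := by
    have := h.subset (by simp : s ∈ l ++ [s])
    simp only [_root_.smallAllowed, List.mem_filter, List.mem_range] at this
    exact this.1
  rw [List.foldl_append, List.foldl_cons, List.foldl_nil, csize_nat, csize_nat]
  have := Nat.mod_lt (l.foldl (fun v s => v * (_root_.satCount (c a) (t a) + (q a - s)) % q a) 1 *
    (_root_.satCount (c a) (t a) + (q a - s))) (by omega : q a > 0)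
  omega

@[fun_prop]
theorem valueRows {q : α → ℕ} {ts : α → List (List (List Bool))} {cs : α → List RawClause}
    (hq : PolyTime q) (hts : PolyTime ts) (hcs : PolyTime cs) :
    PolyTime fun a => valueRows (q a) (ts a) (cs a) := by
  unfold _root_.valueRows
  fun_prop

theorem chosenClauses {q : α → ℕ} {ts : α → List (List (List Bool))}
    {rows : α → List (RawClause × List ℕ)} (hq : PolyTime q) (hq₀ : ∀ a, 0 < q a)
    (hts : PolyTime ts) (hrows : PolyTime rows) :
    PolyTime fun a => chosenClauses (q a) (ts a) (rows a) := by
  unfold _root_.chosenClauses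
  have hR := hrows.polyBound
  refine snd (foldl (b := fun a => csize (rows a) * (csize (rows a) + (csize (rows a) *
      (2 * (csize (q a) + csize (rows a)) + 1 + 1) + 1) + 1 + 1) + 1 +
      (csize (ts a) * (csize (rows a) + 1) + 1) + 1)
    (by fun_prop) (by fun_prop) (by fun_prop) ?_ fun a l₁ h => ?_)
  · exact .add (.add (.add (.mul hR (.add (.add (.add hR (.add (.mul hR (.add (.add (.mul (.const 2)
      (.add hq.polyBound hR)) (.const 1)) (.const 1))) (.const 1))) (.const 1)) (.const 1)))
      (.const 1)) (.add (.mul hts.polyBound (.add hR (.const 1))) (.const 1))) (.const 1)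
  · have h0 : ElimBound (csize (rows a)) (csize (rows a)) (csize (q a) + csize (rows a))
        (csize (rows a)) (rows a, []) := by
      refine ⟨?_, fun r hr => ?_, fun r hr => ?_, fun r hr x hx => ?_, by simp⟩
      · have := length_lt_csize (rows a); dsimp only; omega
      · have := csize_le_of_mem hr
        rw [csize_prod] at this
        dsimp only at this
        omega
      · have := csize_le_of_mem hr
        have := length_lt_csize r.2
        simp only [csize_prod] at *
        omega
      · have h1 := csize_le_of_mem hr
        have h2 := csize_le_of_mem hx
        rw [csize_prod] at h1
        rw [csize_nat] at h2
        dsimp only at h1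
        omega
    refine (foldl_elimStep_bound (hq₀ a) (by simp; omega) l₁ h0).csize_le ?_
    refine (length_foldl_elimStep_le _ _ _).trans ?_
    have := h.length_le
    have := length_lt_csize (ts a)
    simp only [List.length_nil]
    omega

theorem sparsify {q n : α → ℕ} {cs : α → List RawClause} (d : ℕ) (hq : PolyTime q)
    (hq₀ : ∀ a, 0 < q a) (hn : PolyTime n) (hcs : PolyTime cs) :
    PolyTime fun a => sparsify d (q a) (n a) (cs a) := by
  unfold _root_.sparsify
  have := chosenClauses (ts := fun a => _root_.testPoints d (n a))
    (rows := fun a => _root_.valueRows (q a) (_root_.testPoints d (n a))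
      ((cs a).map fun c => _root_.cutAllowed (q a) c)) hq hq₀ (by fun_prop) (by fun_prop)
  exact filter (by fun_prop) (decide_mem (by fun_prop) (this.comp fst'))

@[fun_prop]
theorem validClause {n : α → ℕ} {c : α → RawClause} (d : ℕ) (hn : PolyTime n) (hc : PolyTime c) :
    PolyTime fun a => validClause d (n a) (c a) := by
  unfold _root_.validClause
  fun_prop

@[fun_prop]
theorem sameElements {β : Type} [Code β] [DecidableEq β] [PolyEq β] {l l' : α → List β}
    (hl : PolyTime l) (hl' : PolyTime l') : PolyTime fun a => sameElements (l a) (l' a) := by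
  unfold _root_.sameElements
  fun_prop

@[fun_prop]
theorem validRaw {n : α → ℕ} {cs : α → List RawClause} (d : ℕ) (hn : PolyTime n)
    (hcs : PolyTime cs) : PolyTime fun a => validRaw d (n a) (cs a) := by
  unfold _root_.validRaw
  fun_prop

theorem kernelWord {q : ℕ → ℕ} (d : ℕ) (hq : PolyTime q) (hq₀ : ∀ n, 0 < q n) :
    PolyTime fun y : List Bool × ℕ => kernelWord d q y.1 y.2 := by
  have h1 := isDecoder_decodeRaw.polyTime
  have h2 := isDecoder_decodeRaw.polyTime_encode
  have h3 : PolyTime fun p : (List Bool × ℕ) × List RawClause × List Bool =>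
      _root_.sparsify d (q p.1.2) p.1.2 p.2.1 :=
    sparsify d (by fun_prop) (fun _ => hq₀ _) (by fun_prop) (by fun_prop)
  unfold _root_.kernelWord
  fun_prop

end PolyTime

/-! ### Polynomials of low degree on the cube -/

section cube
variable {n : ℕ} {K : Type} [Field K]

/-- The monomial `∏ i ∈ A, x i`, as a function of truth assignments. -/
def cubeMonomial (K : Type) [Field K] (A : Finset (Fin n)) (τ : Fin n → Bool) : K :=
  if ∀ i ∈ A, τ i = true then 1 else 0

/-- Functions of truth assignments that are given by polynomials of degree at most `k`. -/
def degreeLE (n : ℕ) (K : Type) [Field K] (k : ℕ) : Submodule K ((Fin n → Bool) → K) :=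
  Submodule.span K (Set.range fun A : {A : Finset (Fin n) // A.card ≤ k} => cubeMonomial K A.1)

theorem degreeLE_mono {k k' : ℕ} (h : k ≤ k') : degreeLE n K k ≤ degreeLE n K k' := by
  refine Submodule.span_mono ?_
  rintro _ ⟨A, rfl⟩
  exact ⟨⟨A.1, A.2.trans h⟩, rfl⟩

theorem one_mem_degreeLE (k : ℕ) : (1 : (Fin n → Bool) → K) ∈ degreeLE n K k := by
  refine Submodule.subset_span ⟨⟨∅, by simp⟩, ?_⟩
  funext τ
  simp [cubeMonomial]

theorem variable_mul_mem_degreeLE (i : Fin n) {k : ℕ} {g : (Fin n → Bool) → K}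
    (hg : g ∈ degreeLE n K k) :
    (fun τ => (if τ i = true then 1 else 0) * g τ) ∈ degreeLE n K (k + 1) := by
  induction hg using Submodule.span_induction with
  | mem g hg =>
    obtain ⟨A, rfl⟩ := hg
    refine Submodule.subset_span ⟨⟨insert i A.1, (Finset.card_insert_le _ _).trans
      (Nat.succ_le_succ A.2)⟩, ?_⟩
    funext τ
    by_cases h : τ i = true <;> simp [cubeMonomial, h]
  | zero =>
    convert (degreeLE n K (k + 1)).zero_mem using 1
    funext τ
    simp
  | add g g' _ _ h h' =>
    convert Submodule.add_mem _ h h' using 1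
    funext τ
    simp [mul_add]
  | smul a g _ h =>
    convert Submodule.smul_mem _ a h using 1
    funext τ
    simp

theorem countP_mul_mem_degreeLE (l : List (Literal n)) {k : ℕ} {g : (Fin n → Bool) → K}
    (hg : g ∈ degreeLE n K k) :
    (fun τ => ((l.countP fun l => τ l.1 == l.2 : ℕ) : K) * g τ) ∈ degreeLE n K (k + 1) := by
  induction l with
  | nil =>
    convert (degreeLE n K (k + 1)).zero_mem using 1
    funext τ
    simp
  | cons a l ih =>
    have h1 := variable_mul_mem_degreeLE a.1 hg
    have h2 := degreeLE_mono (Nat.le_succ k) hg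
    rcases a with ⟨i, _ | _⟩
    · convert Submodule.add_mem _ ih (Submodule.sub_mem _ h2 h1) using 1
      funext τ
      cases h : τ i <;> simp [h, add_mul]
    · convert Submodule.add_mem _ ih h1 using 1
      funext τ
      cases h : τ i <;> simp [h, add_mul]

/-- The polynomial of a clause has degree at most the number of its allowed values. -/
theorem prod_sub_mem_degreeLE (l : List (Literal n)) (S : List ℕ) :
    (fun τ => (S.map fun s : ℕ => ((l.countP fun l => τ l.1 == l.2 : ℕ) : K) - s).prod) ∈
      degreeLE n K S.length := by
  induction S with
  | nil => exact one_mem_degreeLE 0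
  | cons s S ih =>
    rw [List.length_cons]
    convert Submodule.sub_mem _ (countP_mul_mem_degreeLE l ih)
      (Submodule.smul_mem _ (s : K) (degreeLE_mono (Nat.le_succ _) ih)) using 1
    funext τ
    simp [sub_mul]

/-- A polynomial of degree at most `k` that vanishes at all assignments with at most `k` true
variables vanishes identically. -/
theorem eq_zero_of_mem_degreeLE {k : ℕ} {g : (Fin n → Bool) → K} (hg : g ∈ degreeLE n K k)
    (h : ∀ B : Finset (Fin n), B.card ≤ k → g (fun i => decide (i ∈ B)) = 0) : g = 0 := by
  obtain ⟨c, rfl⟩ := (Submodule.mem_span_range_iff_exists_fun K).1 hg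
  suffices hc : ∀ m, ∀ A : {A : Finset (Fin n) // A.card ≤ k}, A.1.card = m → c A = 0 by
    simp [fun A => hc _ A rfl]
  intro m
  induction m using Nat.strong_induction_on with
  | _ m ih =>
    intro A hA
    have h1 := h A.1 A.2
    rw [Finset.sum_apply, Finset.sum_eq_single A] at h1
    · simpa [cubeMonomial] using h1
    · intro A' _ hne
      by_cases hs : A'.1 ⊆ A.1
      · rw [ih A'.1.card (hA ▸ Finset.card_lt_card (hs.ssubset_of_ne fun h => hne (Subtype.ext h)))
          A' rfl, zero_smul]
        rfl
      · have : ¬ ∀ i ∈ A'.1, i ∈ A.1 := hs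
        simp [cubeMonomial, this]
    · simp

end cube

/-! ### Correctness of the elimination -/

theorem subset_foldl_elimStep (q : ℕ) {β : Type} (l : List β)
    (s : List (RawClause × List ℕ) × List RawClause) :
    s.2 ⊆ (l.foldl (fun s _ => elimStep q s) s).2 := by
  induction l generalizing s with
  | nil => simp
  | cons b l ih =>
    refine List.Subset.trans ?_ (ih (elimStep q s))
    rcases elimStep_eq q s with ⟨-, he⟩ | ⟨p, -, -, he⟩ <;> rw [he]
    · simp
    · exact List.subset_cons_self _ _

theorem cast_combineRows {q : ℕ} (hq : 0 < q) (a b : ℕ) {T : Type} (ts : List T) (v w : List ℕ)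
    (f g : T → ZMod q) (hv : v.map (Nat.cast : ℕ → ZMod q) = ts.map f)
    (hw : w.map (Nat.cast : ℕ → ZMod q) = ts.map g) :
    (combineRows q a b v w).map (Nat.cast : ℕ → ZMod q) = ts.map fun t => a * f t - b * g t := by
  induction ts generalizing v w with
  | nil => simp_all [combineRows]
  | cons t ts ih =>
    rcases v with _ | ⟨x, v⟩
    · simp at hv
    rcases w with _ | ⟨y, w⟩
    · simp at hw
    simp only [List.map_cons, List.cons.injEq] at hv hw
    have := ih v w hv.2 hw.2
    simp only [combineRows] at this
    simp only [combineRows, List.zip_cons_cons, List.map_cons, this, List.cons.injEq, and_true]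
    rw [ZMod.natCast_mod, Nat.cast_add, Nat.cast_mul, Nat.cast_mul,
      Nat.cast_sub (Nat.mod_lt _ hq).le, ZMod.natCast_mod, ZMod.natCast_self, hv.1, hw.1]
    ring

/-- If the functions `g j` belong to a space `W` in which a function that vanishes at the points
`ts` vanishes at `τ`, and the functions of the chosen rows vanish at `τ`, then all functions `g j`
vanish at `τ`. Elimination of a column passes to the subspace of the functions that vanish at the
corresponding point. -/
theorem apply_eq_zero_of_chosen {q : ℕ} [Fact q.Prime] {ι T Ω : Type} (idx : List ι)
    (lab : ι → RawClause) (pt : T → Ω) (τ : Ω) (ts : List T) (W : Submodule (ZMod q) (Ω → ZMod q))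
    (hW : ∀ h ∈ W, (∀ t ∈ ts, h (pt t) = 0) → h τ = 0) (vec : ι → List ℕ) (g : ι → Ω → ZMod q)
    (hg : ∀ j ∈ idx, g j ∈ W) (hlt : ∀ j ∈ idx, ∀ x ∈ vec j, x < q)
    (hvec : ∀ j ∈ idx, (vec j).map (Nat.cast : ℕ → ZMod q) = ts.map fun t => g j (pt t))
    (kept : List RawClause)
    (hkept : ∀ j ∈ idx, lab j ∈ (ts.foldl (fun s _ => elimStep q s)
      (idx.map fun j => (lab j, vec j), kept)).2 → g j τ = 0) :
    ∀ j ∈ idx, g j τ = 0 := by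
  have hq : 0 < q := (Fact.out : q.Prime).pos
  induction ts generalizing W vec g kept with
  | nil => exact fun j hj => hW _ (hg j hj) (by simp)
  | cons t ts ih =>
    let W' : Submodule (ZMod q) (Ω → ZMod q) := W ⊓ LinearMap.ker (LinearMap.proj (pt t))
    have hmem : ∀ h, h ∈ W' ↔ h ∈ W ∧ h (pt t) = 0 := fun h => by simp [W']
    have hW' : ∀ h ∈ W', (∀ t ∈ ts, h (pt t) = 0) → h τ = 0 := fun h hh hz =>
      hW h ((hmem h).1 hh).1 (List.forall_mem_cons.2 ⟨((hmem h).1 hh).2, hz⟩)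
    have hhead : ∀ j ∈ idx, (((vec j).headD 0 : ℕ) : ZMod q) = g j (pt t) ∧
        ((vec j).tail).map (Nat.cast : ℕ → ZMod q) = ts.map fun t => g j (pt t) := by
      intro j hj
      have := hvec j hj
      rcases h : vec j with _ | ⟨x, v⟩
      · simp [h] at this
      · simpa [h] using this
    rw [List.foldl_cons] at hkept
    rcases elimStep_eq q (idx.map fun j => (lab j, vec j), kept) with ⟨hz, he⟩ | ⟨p, hp, hp0, he⟩
    · rw [he] at hkept
      simp only [List.map_map, Function.comp_def] at hkept
      refine ih W' hW' (fun j => (vec j).tail) g (fun j hj => (hmem _).2 ⟨hg j hj, ?_⟩)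
        (fun j hj x hx => hlt j hj x (List.mem_of_mem_tail hx)) (fun j hj => (hhead j hj).2) kept
        hkept
      rw [← (hhead j hj).1, hz (lab j, vec j) (List.mem_map_of_mem hj), Nat.cast_zero]
    · obtain ⟨j₀, hj₀, rfl⟩ := List.mem_map.1 hp
      dsimp only at hp0
      rw [he] at hkept
      simp only [List.map_map, Function.comp_def] at hkept
      have hj₀τ : g j₀ τ = 0 :=
        hkept j₀ hj₀ (subset_foldl_elimStep q ts _ (List.mem_cons_self ..))
      have ha : (((vec j₀).headD 0 : ℕ) : ZMod q) ≠ 0 := by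
        have hx : (vec j₀).headD 0 < q := by
          rcases h : vec j₀ with _ | ⟨x, v⟩
          · simpa using hq
          · exact hlt j₀ hj₀ x (by simp [h])
        rw [Ne, ZMod.natCast_eq_zero_iff]
        exact fun hd => hp0 (Nat.eq_zero_of_dvd_of_lt hd hx)
      have key := ih W' hW'
        (fun j => combineRows q ((vec j₀).headD 0) ((vec j).headD 0) (vec j).tail (vec j₀).tail)
        (fun j => (((vec j₀).headD 0 : ℕ) : ZMod q) • g j - (((vec j).headD 0 : ℕ) : ZMod q) • g j₀)
        (fun j hj => (hmem _).2 ⟨W.sub_mem (W.smul_mem _ (hg j hj)) (W.smul_mem _ (hg j₀ hj₀)), ?_⟩)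
        (fun j hj x hx => ?_)
        (fun j hj => cast_combineRows hq _ _ ts _ _ _ _ (hhead j hj).2 (hhead j₀ hj₀).2)
        (lab j₀ :: kept) (fun j hj hl => ?_)
      · intro j hj
        have h1 := key j hj
        simp only [Pi.sub_apply, Pi.smul_apply, hj₀τ, smul_eq_mul, mul_zero, sub_zero] at h1
        exact (mul_eq_zero.1 h1).resolve_left ha
      · simp only [Pi.sub_apply, Pi.smul_apply, smul_eq_mul, (hhead j hj).1, (hhead j₀ hj₀).1]
        ring
      · simp only [combineRows, List.mem_map] at hx
        obtain ⟨y, -, rfl⟩ := hx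
        exact Nat.mod_lt _ hq
      · simp [hkept j hj hl, hj₀τ]

/-! ### Raw data and instances -/

theorem exists_bits_eq {b : List Bool} (h : b.reverse.headD true = true) : ∃ m : ℕ, m.bits = b := by
  induction b with
  | nil => exact ⟨0, by simp⟩
  | cons b l ih =>
    rcases l with _ | ⟨b', l⟩
    · simp only [List.reverse_cons, List.reverse_nil, List.nil_append, List.headD_cons] at h
      subst h
      exact ⟨1, by simp⟩
    · have h' : (b' :: l).reverse.headD true = true := by
        rw [List.reverse_cons] at h
        rcases hr : (b' :: l).reverse with _ | ⟨b'', l'⟩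
        · rfl
        · simpa [hr] using h
      obtain ⟨m, hm⟩ := ih h'
      refine ⟨Nat.bit b m, ?_⟩
      rw [Nat.bits_append_bit m b, hm]
      rintro rfl
      simp at hm

theorem headD_reverse_bits (m : ℕ) : m.bits.reverse.headD true = true := by
  induction m using Nat.binaryRec' with
  | zero => simp
  | bit b m hm ih =>
    rw [Nat.bits_append_bit m b hm, List.reverse_cons]
    rcases hr : m.bits.reverse with _ | ⟨b', l⟩
    · have h0 : m = 0 := bits_injective (by simpa using hr)
      simp [hm h0]
    · simpa [hr] using ih

theorem mem_varNames {n : ℕ} {v : List Bool} : v ∈ varNames n ↔ ∃ i < n, Nat.bits i = v := by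
  simp [varNames]

theorem bits_mem_varNames {n i : ℕ} : i.bits ∈ varNames n ↔ i < n := by
  rw [mem_varNames]
  exact ⟨fun ⟨j, hj, h⟩ => bits_injective h ▸ hj, fun h => ⟨i, h, rfl⟩⟩

/-- The raw data of a literal. -/
def rawLiteral {n : ℕ} (l : Literal n) : List Bool × Bool := ((l.1 : ℕ).bits, l.2)

theorem rawLiteral_injective {n : ℕ} : Function.Injective (rawLiteral (n := n)) := by
  rintro ⟨i, s⟩ ⟨j, t⟩ h
  simp only [rawLiteral, Prod.mk.injEq] at h
  exact Prod.ext (Fin.ext (bits_injective h.1)) h.2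

theorem List.exists_map_eq {α β : Type} {f : α → β} {l : List β} (h : ∀ b ∈ l, ∃ a, f a = b) :
    ∃ l' : List α, l'.map f = l := by
  have : l ∈ Set.range (List.map f) := by
    rw [Set.range_list_map]
    exact h
  exact this

theorem validClause_iff {d n : ℕ} {c : RawClause} :
    validClause d n c = true ↔ ∃ C : ConstrainedClause d n, C.raw = c := by
  simp only [validClause, Bool.and_eq_true, decide_eq_true_eq, List.all_eq_true, mem_varNames]
  constructor
  · rintro ⟨⟨⟨⟨h1, h2⟩, h3⟩, h4⟩, h5⟩
    obtain ⟨ls, hls⟩ : ∃ ls : List (Literal n), ls.map rawLiteral = c.1 :=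
      List.exists_map_eq fun l hl => by
        obtain ⟨i, hi, hv⟩ := h2 l hl
        exact ⟨(⟨i, hi⟩, l.2), Prod.ext hv rfl⟩
    obtain ⟨S, hS⟩ : ∃ S : List ℕ, S.map Nat.bits = c.2 :=
      List.exists_map_eq fun b hb => exists_bits_eq (h4 b hb)
    refine ⟨⟨ls, ?_, S, ?_, ?_⟩, Prod.ext hls hS⟩
    · rw [← hls] at h1
      exact List.Nodup.of_map _ h1
    · rw [← hS] at h3
      exact List.Nodup.of_map _ h3
    · rw [← hS] at h5
      simpa using h5
  · rintro ⟨C, rfl⟩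
    refine ⟨⟨⟨⟨C.literals_nodup.map rawLiteral_injective, ?_⟩,
      C.allowed_nodup.map bits_injective⟩, ?_⟩, by simpa [ConstrainedClause.raw] using C.allowed_length⟩
    · simp only [ConstrainedClause.raw, List.forall_mem_map]
      exact fun l _ => ⟨l.1, l.1.2, rfl⟩
    · simp only [ConstrainedClause.raw, List.forall_mem_map]
      exact fun s _ => headD_reverse_bits s

theorem sameElements_raw_iff {d n : ℕ} (c c' : ConstrainedClause d n) :
    sameElements c.raw.1 c'.raw.1 = false ↔ c.literals.toFinset ≠ c'.literals.toFinset := by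
  rw [← Bool.not_eq_true, Ne, not_iff_not]
  change sameElements (c.literals.map rawLiteral) (c'.literals.map rawLiteral) = true ↔ _
  simp only [sameElements, Bool.and_eq_true, List.all_eq_true, decide_eq_true_eq,
    List.forall_mem_map, List.mem_map_of_injective rawLiteral_injective]
  rw [Finset.ext_iff]
  simp only [List.mem_toFinset]
  exact ⟨fun h a => ⟨h.1 a, h.2 a⟩, fun h => ⟨fun a => (h a).1, fun a => (h a).2⟩⟩

theorem validRaw_iff {d n : ℕ} {cs : List RawClause} :
    validRaw d n cs = true ↔
      ∃ I : GenSatInstance d n, I.clauses.map ConstrainedClause.raw = cs := by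
  simp only [validRaw, Bool.and_eq_true, decide_eq_true_eq, List.all_eq_true]
  constructor
  · rintro ⟨h1, h2⟩
    obtain ⟨l, rfl⟩ : ∃ l : List (ConstrainedClause d n), l.map ConstrainedClause.raw = cs :=
      List.exists_map_eq fun c hc => validClause_iff.1 (h1 c hc)
    rw [List.pairwise_map] at h2
    exact ⟨⟨l, h2.imp fun h => (sameElements_raw_iff _ _).1 h⟩, rfl⟩
  · rintro ⟨I, rfl⟩
    refine ⟨?_, ?_⟩
    · simp only [List.forall_mem_map]
      exact fun C _ => validClause_iff.2 ⟨C, rfl⟩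
    · rw [List.pairwise_map]
      exact I.clauses_distinct.imp fun h => (sameElements_raw_iff _ _).2 h

/-! ### The polynomial of a clause -/

/-- Remove the allowed values that are not less than `q`. -/
def ConstrainedClause.cut {d n : ℕ} (q : ℕ) (c : ConstrainedClause d n) : ConstrainedClause d n where
  literals := c.literals
  literals_nodup := c.literals_nodup
  allowed := c.allowed.filter (· < q)
  allowed_nodup := c.allowed_nodup.filter _
  allowed_length := (List.length_filter_le _ _).trans c.allowed_length

theorem ConstrainedClause.raw_cut {d n : ℕ} (q : ℕ) (c : ConstrainedClause d n) :
    (c.cut q).raw = cutAllowed q c.raw := by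
  simp only [raw, cut, cutAllowed, List.filter_map, Function.comp_def, bits_mem_varNames]

/-- The assignment that makes exactly the variables in `t` true. -/
def pointAssignment (n : ℕ) (t : List (List Bool)) (i : Fin n) : Bool :=
  decide ((i : ℕ).bits ∈ t)

theorem satCount_raw {d n : ℕ} (c : ConstrainedClause d n) (t : List (List Bool)) :
    satCount c.raw t = c.numSat (pointAssignment n t) := by
  simp only [satCount, ConstrainedClause.raw, ConstrainedClause.numSat, List.filter_map,
    List.length_map, List.countP_eq_length_filter, Function.comp_def, pointAssignment]
  rfl

theorem mem_smallAllowed_raw {d n q s : ℕ} (c : ConstrainedClause d n) :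
    s ∈ smallAllowed q c.raw ↔ s < q ∧ s ∈ c.allowed := by
  simp [smallAllowed, ConstrainedClause.raw, List.mem_map_of_injective bits_injective]

theorem length_smallAllowed_raw_le {d n : ℕ} (q : ℕ) (c : ConstrainedClause d n) :
    (smallAllowed q c.raw).length ≤ d := by
  have h1 : (smallAllowed q c.raw).Nodup := List.nodup_range.filter _
  exact ((List.subperm_of_subset h1 fun s hs => ((mem_smallAllowed_raw c).1 hs).2).length_le).trans
    c.allowed_length

/-- The polynomial of a clause, which vanishes modulo `q` at the assignments that satisfy the
clause modulo `q`. -/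
def clausePoly {d n : ℕ} (q : ℕ) (c : ConstrainedClause d n) (τ : Fin n → Bool) : ZMod q :=
  ((smallAllowed q c.raw).map fun s : ℕ => (c.numSat τ : ZMod q) - s).prod

theorem clausePoly_eq_zero_iff {d n q : ℕ} [Fact q.Prime] (c : ConstrainedClause d n)
    (τ : Fin n → Bool) : clausePoly q c τ = 0 ↔ c.numSat τ % q ∈ c.allowed := by
  have hq : 0 < q := (Fact.out : q.Prime).pos
  have key : ∀ s, s < q → ((c.numSat τ : ZMod q) - s = 0 ↔ s = c.numSat τ % q) := by
    intro s hs
    rw [sub_eq_zero, ZMod.natCast_eq_natCast_iff', Nat.mod_eq_of_lt hs, eq_comm]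
  simp only [clausePoly, List.prod_eq_zero_iff, List.mem_map, mem_smallAllowed_raw]
  constructor
  · rintro ⟨s, ⟨hs, hm⟩, h0⟩
    rwa [← (key s hs).1 h0]
  · intro h
    exact ⟨_, ⟨Nat.mod_lt _ hq, h⟩, (key _ (Nat.mod_lt _ hq)).2 rfl⟩

theorem clausePoly_mem_degreeLE {d n q : ℕ} [Fact q.Prime] (c : ConstrainedClause d n) :
    clausePoly q c ∈ degreeLE n (ZMod q) d :=
  degreeLE_mono (length_smallAllowed_raw_le q c) (prod_sub_mem_degreeLE c.literals _)

theorem cast_clauseValue {d n q : ℕ} (c : ConstrainedClause d n) (t : List (List Bool)) :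
    (clauseValue q c.raw t : ZMod q) = clausePoly q c (pointAssignment n t) := by
  have key : ∀ (k : ℕ) (S : List ℕ) (v : ℕ), (∀ s ∈ S, s < q) →
      ((S.foldl (fun v s => v * (k + (q - s)) % q) v : ℕ) : ZMod q) =
        v * (S.map fun s : ℕ => (k : ZMod q) - s).prod := by
    intro k S
    induction S with
    | nil => simp
    | cons s S ih =>
      intro v h
      rw [List.foldl_cons, ih _ fun s hs => h s (List.mem_cons_of_mem _ hs), ZMod.natCast_mod,
        Nat.cast_mul, Nat.cast_add, Nat.cast_sub (h s List.mem_cons_self).le, ZMod.natCast_self,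
        List.map_cons, List.prod_cons]
      ring
  rw [clauseValue, key _ _ _ fun s hs => ((mem_smallAllowed_raw c).1 hs).1, satCount_raw, clausePoly]
  simp

theorem clauseValue_lt {q : ℕ} (hq : 1 < q) (c : RawClause) (t : List (List Bool)) :
    clauseValue q c t < q := by
  unfold clauseValue
  rcases (smallAllowed q c).eq_nil_or_concat with h | ⟨l, s, h⟩
  · simpa [h] using hq
  · rw [h, List.concat_eq_append, List.foldl_append, List.foldl_cons, List.foldl_nil]
    exact Nat.mod_lt _ (by omega)

/-! ### The test points -/

theorem length_testPoints (d n : ℕ) : (testPoints d n).length = n ^ d + 1 := by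
  have : (varTuples n d).length = n ^ d := by
    induction d with
    | zero => rfl
    | succ d ih =>
      simp [varTuples, varNames, List.length_flatMap, ih, pow_succ]
  rw [testPoints, List.length_cons, this]

theorem mem_varTuples {n d : ℕ} {t : List (List Bool)} :
    t ∈ varTuples n d ↔ t.length = d ∧ ∀ v ∈ t, v ∈ varNames n := by
  induction d generalizing t with
  | zero =>
    simp only [varTuples, List.mem_singleton, List.length_eq_zero_iff]
    constructor
    · rintro rfl
      simp
    · exact And.left
  | succ d ih =>
    simp only [varTuples, List.mem_flatMap, List.mem_map, ih]
    constructor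
    · rintro ⟨t, ⟨rfl, ht⟩, v, hv, rfl⟩
      exact ⟨rfl, List.forall_mem_cons.2 ⟨hv, ht⟩⟩
    · rintro ⟨hl, ht⟩
      rcases t with _ | ⟨v, t⟩
      · simp at hl
      · rw [List.forall_mem_cons] at ht
        exact ⟨t, ⟨by simpa using hl, ht.2⟩, v, ht.1, rfl⟩

/-- Every assignment with at most `d` true variables is a test point. -/
theorem exists_mem_testPoints {d n : ℕ} (B : Finset (Fin n)) (hB : B.card ≤ d) :
    ∃ t ∈ testPoints d n, pointAssignment n t = fun i => decide (i ∈ B) := by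
  rcases B.eq_empty_or_nonempty with rfl | ⟨b, hb⟩
  · exact ⟨[], List.mem_cons_self, by funext i; simp [pointAssignment]⟩
  · let l : List (Fin n) := B.toList ++ List.replicate (d - B.card) b
    have hl : ∀ i, i ∈ l ↔ i ∈ B := by
      intro i
      simp only [l, List.mem_append, Finset.mem_toList, List.mem_replicate]
      constructor
      · rintro (h | ⟨-, rfl⟩)
        exacts [h, hb]
      · exact Or.inl
    refine ⟨l.map fun i : Fin n => (i : ℕ).bits, List.mem_cons_of_mem _ (mem_varTuples.2 ⟨?_, ?_⟩), ?_⟩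
    · simp [l]
      omega
    · simp only [List.forall_mem_map, bits_mem_varNames]
      exact fun i _ => i.2
    · funext i
      have hinj : Function.Injective fun i : Fin n => (i : ℕ).bits :=
        fun i j h => Fin.ext (bits_injective h)
      rw [pointAssignment, Bool.eq_iff_iff, decide_eq_true_eq, decide_eq_true_eq, ← hl,
        ← List.mem_map_of_injective hinj]

/-! ### Correctness of the sparsification -/

theorem exists_sparsify_instance {d n q : ℕ} [hqp : Fact q.Prime] (I : GenSatInstance d n) :
    ∃ J : GenSatInstance d n,
      J.clauses.map ConstrainedClause.raw = sparsify d q n (I.clauses.map ConstrainedClause.raw) ∧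
      J.clauses.length ≤ n ^ d + 1 ∧ (∀ c ∈ J.clauses, ∀ s ∈ c.allowed, s < q) ∧
      (J.SatisfiableMod q ↔ I.SatisfiableMod q) := by
  set cs := I.clauses.map (ConstrainedClause.cut q) with hcs
  have hraw : (I.clauses.map ConstrainedClause.raw).map (fun c => cutAllowed q c) =
      cs.map ConstrainedClause.raw := by
    rw [hcs, List.map_map, List.map_map]
    exact List.map_congr_left fun c _ => (c.raw_cut q).symm
  set ch := chosenClauses q (testPoints d n)
    (valueRows q (testPoints d n) (cs.map ConstrainedClause.raw)) with hch
  have hdist : cs.Pairwise fun c c' => c.literals.toFinset ≠ c'.literals.toFinset := by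
    rw [hcs, List.pairwise_map]
    exact I.clauses_distinct
  let J : GenSatInstance d n :=
    ⟨cs.filter fun c => decide (c.raw ∈ ch), hdist.sublist List.filter_sublist⟩
  have hJ : J.clauses.map ConstrainedClause.raw =
      sparsify d q n (I.clauses.map ConstrainedClause.raw) := by
    rw [sparsify, hraw, List.filter_map]
    rfl
  have hcut : ∀ c ∈ cs, ∀ s ∈ c.allowed, s < q := by
    simp only [hcs, List.forall_mem_map]
    intro c _ s hs
    simpa using (List.mem_filter.1 hs).2
  -- Remainders modulo `q` are less than `q`.
  have hsat : ∀ (c : ConstrainedClause d n) (τ : Fin n → Bool),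
      c.numSat τ % q ∈ (c.cut q).allowed ↔ c.numSat τ % q ∈ c.allowed := by
    intro c τ
    simp [ConstrainedClause.cut, Nat.mod_lt _ hqp.out.pos]
  refine ⟨J, hJ, ?_, fun c hc => hcut c (List.mem_filter.1 hc).1, ?_⟩
  · have h1 : (J.clauses.map ConstrainedClause.raw).Nodup := by
      refine List.pairwise_map.2 (J.clauses_distinct.imp fun {c c'} h he => h ?_)
      have h2 : c.literals.map rawLiteral = c'.literals.map rawLiteral := congrArg Prod.fst he
      rw [rawLiteral_injective.list_map h2]
    have h2 : J.clauses.map ConstrainedClause.raw ⊆ ch := by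
      intro r hr
      obtain ⟨c, hc, rfl⟩ := List.mem_map.1 hr
      simpa using (List.mem_filter.1 hc).2
    have h3 := (List.subperm_of_subset h1 h2).length_le
    have h4 := length_foldl_elimStep_le q (testPoints d n)
      (valueRows q (testPoints d n) (cs.map ConstrainedClause.raw), [])
    rw [length_testPoints] at h4
    rw [List.length_map] at h3
    exact h3.trans (h4.trans (by simp))
  · refine exists_congr fun τ => ⟨fun h => ?_, fun h => ?_⟩
    · have hall : ∀ c ∈ cs, clausePoly q c τ = 0 := by
        refine apply_eq_zero_of_chosen cs ConstrainedClause.raw (pointAssignment n) τ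
          (testPoints d n) (degreeLE n (ZMod q) d) (fun g hg hz => ?_)
          (fun c => (testPoints d n).map fun t => clauseValue q c.raw t) (fun c => clausePoly q c)
          (fun c _ => clausePoly_mem_degreeLE c) (fun c _ x hx => ?_) (fun c _ => ?_) []
          (fun c hc hl => ?_)
        · rw [eq_zero_of_mem_degreeLE hg fun B hB => ?_]
          · rfl
          · obtain ⟨t, ht, he⟩ := exists_mem_testPoints B hB
            rw [← he]
            exact hz t ht
        · obtain ⟨t, -, rfl⟩ := List.mem_map.1 hx
          exact clauseValue_lt hqp.out.one_lt _ _
        · rw [List.map_map]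
          exact List.map_congr_left fun t _ => cast_clauseValue c t
        · rw [clausePoly_eq_zero_iff]
          refine h c (List.mem_filter.2 ⟨hc, ?_⟩)
          rw [decide_eq_true_eq, hch, chosenClauses, valueRows, List.map_map]
          exact hl
      intro c hc
      rw [← hsat]
      exact (clausePoly_eq_zero_iff (c.cut q) τ).1 (hall _ (List.mem_map_of_mem hc))
    · intro c hc
      obtain ⟨c', hc', rfl⟩ := List.mem_map.1 (List.mem_filter.1 hc).1
      exact (hsat c' τ).2 (h c' hc')

/-! ### From coded words to words on the tape -/

namespace Cmd

/-- Move the whole main stack to the left stack. -/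
def toLeft : Cmd :=
  .loop .main Option.isSome
    (.ite .main (· == some none) (.seq (.pop .main) (.push .left none))
      (.ite .main (· == some (some true)) (.seq (.pop .main) (.push .left (some true)))
        (.seq (.pop .main) (.push .left (some false)))))

theorem run_toLeft (w l r d : List (Option Bool)) :
    Run toLeft (store w l r d) (store [] (w.reverse ++ l) r d) (5 * w.length + 1) := by
  induction w generalizing l with
  | nil => exact .loop_false rfl
  | cons a w ih =>
    have ih' := ih (a :: l)
    rw [List.reverse_cons, List.append_assoc, List.singleton_append, List.length_cons]
    rcases a with _ | _ | _
    · exact (Run.loop_true rfl (.ite_true rfl (.seq .pop_main .push_left)) ih').mono (by omega)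
    · exact (Run.loop_true rfl (.ite_false rfl (.ite_false rfl (.seq .pop_main .push_left)))
        ih').mono (by omega)
    · exact (Run.loop_true rfl (.ite_false rfl (.ite_true rfl (.seq .pop_main .push_left)))
        ih').mono (by omega)

/-- Push the symbols of the left stack onto the main stack, preceded by the words `p a`. -/
def fromLeft (p : Option Bool → List (Option Bool)) : Cmd :=
  .loop .left Option.isSome
    (.ite .left (· == some none) (.seq (.pop .left) (pushWord (p none)))
      (.ite .left (· == some (some true)) (.seq (.pop .left) (pushWord (p (some true))))
        (.seq (.pop .left) (pushWord (p (some false))))))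

theorem run_fromLeft (p : Option Bool → List (Option Bool)) {L : ℕ} (hL : ∀ a, (p a).length ≤ L)
    (w m r d : List (Option Bool)) :
    Run (fromLeft p) (store m w r d) (store (w.reverse.flatMap p ++ m) [] r d)
      ((L + 6) * w.length + 1) := by
  induction w generalizing m with
  | nil => exact (Run.loop_false rfl).mono (by simp)
  | cons a w ih =>
    have ih' := ih (p a ++ m)
    have hl := hL a
    have he : (a :: w).reverse.flatMap p ++ m = w.reverse.flatMap p ++ (p a ++ m) := by simp
    rw [he, List.length_cons, mul_add]
    rcases a with _ | _ | _
    · exact (Run.loop_true rfl (.ite_true rfl (.seq .pop_left (run_pushWord _ _ _ _ _))) ih').mono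
        (by omega)
    · exact (Run.loop_true rfl (.ite_false rfl (.ite_false rfl (.seq .pop_left
        (run_pushWord _ _ _ _ _)))) ih').mono (by omega)
    · exact (Run.loop_true rfl (.ite_false rfl (.ite_true rfl (.seq .pop_left
        (run_pushWord _ _ _ _ _)))) ih').mono (by omega)

/-- Replace a word by its codeword. -/
def encodeTape : Cmd :=
  .seq toLeft (.seq (.push .main (some false)) (fromLeft fun a => some true :: (code a).word))

theorem length_word_code_symbol (a : Option Bool) : (code a).word.length ≤ 5 := by
  rcases a with _ | _ | _ <;> decide

theorem run_encodeTape (w : List (Option Bool)) :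
    Run encodeTape (store w [] [] []) (store (code w).word [] [] []) (20 * w.length + 3) := by
  have h := Run.seq (run_toLeft w [] [] []) (.seq (Run.push_main (a := some false))
    (run_fromLeft (fun a => some true :: (code a).word) (L := 6)
      (fun a => Nat.succ_le_succ (length_word_code_symbol a)) _ _ _ _))
  have key : ∀ w : List (Option Bool), (w.flatMap fun a => some true :: (code a).word) ++
      [some false] = (code w).word := by
    intro w
    induction w with
    | nil => rfl
    | cons a w ih =>
      rw [List.flatMap_cons, List.append_assoc, ih]
      rfl
  rw [List.append_nil, List.reverse_reverse, key] at h
  exact h.mono (by simp; omega)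

/-- Replace the codeword of a word by the word itself. -/
def decodeTape : Cmd :=
  .seq (.loop .main (· == some (some true)) (.seq (.pop .main)
    (.ite .main (· == some (some false)) (.seq (.pop .main) (.push .left none))
      (.seq (.pop .main) (.ite .main (· == some (some true))
        (.seq (.pop .main) (.seq (.pop .main) (.seq (.pop .main) (.seq (.pop .main)
          (.push .left (some true))))))
        (.seq (.pop .main) (.seq (.pop .main) (.push .left (some false)))))))))
    (.seq (.pop .main) (fromLeft fun a => [a]))

theorem run_decodeTape (w : List (Option Bool)) :
    Run decodeTape (store (code w).word [] [] []) (store w [] [] []) (20 * w.length + 3) := by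
  have key : ∀ l : List (Option Bool),
      Run (.loop .main (· == some (some true)) (.seq (.pop .main)
        (.ite .main (· == some (some false)) (.seq (.pop .main) (.push .left none))
          (.seq (.pop .main) (.ite .main (· == some (some true))
            (.seq (.pop .main) (.seq (.pop .main) (.seq (.pop .main) (.seq (.pop .main)
              (.push .left (some true))))))
            (.seq (.pop .main) (.seq (.pop .main) (.push .left (some false)))))))))
      (store (code w).word l [] []) (store [some false] (w.reverse ++ l) [] [])
      (10 * w.length + 1) := by
    induction w with
    | nil => exact fun l => .loop_false rfl
    | cons a w ih =>
      intro l
      have ih' := ih (a :: l)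
      rw [List.reverse_cons, List.append_assoc, List.singleton_append, List.length_cons]
      rcases a with _ | _ | _
      · exact (Run.loop_true rfl (.seq .pop_main (.ite_true rfl (.seq .pop_main .push_left)))
          ih').mono (by omega)
      · exact (Run.loop_true rfl (.seq .pop_main (.ite_false rfl (.seq .pop_main (.ite_false rfl
          (.seq .pop_main (.seq .pop_main .push_left)))))) ih').mono (by omega)
      · exact (Run.loop_true rfl (.seq .pop_main (.ite_false rfl (.seq .pop_main (.ite_true rfl
          (.seq .pop_main (.seq .pop_main (.seq .pop_main (.seq .pop_main .push_left)))))))) 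
          ih').mono (by omega)
  have h := Run.seq (key []) (.seq .pop_main (run_fromLeft (fun a => [a]) (L := 1)
    (fun a => le_rfl) _ _ _ _))
  simp only [List.flatMap_singleton', List.append_nil, List.reverse_reverse,
    List.length_reverse] at h
  exact h.mono (by omega)

end Cmd

theorem csize_word_le (w : List (Option Bool)) : csize w ≤ 6 * w.length + 1 := by
  have := csize_list_le (l := w) (B := 5) fun a _ => by
    rw [csize, ← SExp.length_word]
    exact Cmd.length_word_code_symbol a
  omega

/-- A polynomial-time function on words is computed by a polynomial-time Turing machine. -/
theorem PolyTime.nonempty_tm2 {α β : Type} {ea : α → List (Option Bool)}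
    {eb : β → List (Option Bool)} {f : α → β} {g : List (Option Bool) → List (Option Bool)}
    (hg : PolyTime g) (h : ∀ a, g (ea a) = eb (f a)) :
    Nonempty (Turing.TM2ComputableInPolyTime ea eb f) := by
  obtain ⟨c, t, ht, hs, hr⟩ := hg
  have hb : PolyBound fun w : List (Option Bool) => 20 * csize w + 6 + 21 * t w :=
    .add (.add (.mul (.const _) .csize) (.const _)) (.mul (.const _) ht)
  obtain ⟨k, hk⟩ := hb
  refine Cmd.polyTime (.seq .encodeTape (.seq c .decodeTape)) (3 * k) fun a => ?_
  have h1 := hr (ea a) [] [] []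
  rw [List.append_nil, List.append_nil, h] at h1
  refine (Run.seq (Cmd.run_encodeTape _) (.seq h1 (Cmd.run_decodeTape _))).mono ?_
  have h2 : ((ea a).length + 2) ^ (3 * k) ≥ (csize (ea a) + 2) ^ k := by
    rw [pow_mul]
    refine Nat.pow_le_pow_left ((Nat.add_le_add_right (csize_word_le _) 2).trans ?_) k
    nlinarith [Nat.zero_le ((ea a).length ^ 3), Nat.zero_le ((ea a).length ^ 2)]
  have h3 := hk (ea a)
  have h4 := hs (ea a)
  have h5 := length_lt_csize (ea a)
  have h6 := length_lt_csize (eb (f a))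
  rw [h] at h4
  dsimp only at h3
  omega

/-- A polynomial-time function on pairs of a word and a parameter is computed by a polynomial-time
Turing machine. -/
theorem PolyTime.nonempty_tm2_encodePair {f : List Bool × ℕ → List Bool × ℕ} (hf : PolyTime f) :
    Nonempty (Turing.TM2ComputableInPolyTime encodePair encodePair f) := by
  have htl : PolyTime fun o : Option Bool => o.toList := PolyTime.id.toList
  have h : PolyTime fun w : List (Option Bool) =>
      (f (w.flatMap Option.toList, (w.filter fun o => o.toList.isEmpty).length)).1.map some ++
        (List.range (f (w.flatMap Option.toList,
          (w.filter fun o => o.toList.isEmpty).length)).2).map fun _ => none := by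
    have hp : PolyTime fun w : List (Option Bool) =>
        f (w.flatMap Option.toList, (w.filter fun o => o.toList.isEmpty).length) := by
      fun_prop
    fun_prop
  refine h.nonempty_tm2 fun ⟨x, n⟩ => ?_
  have h1 : (encodePair (x, n)).flatMap Option.toList = x := by
    simp [encodePair, List.flatMap_map]
  have h2 : ((encodePair (x, n)).filter fun o => o.toList.isEmpty).length = n := by
    simp [encodePair, List.filter_map, Function.comp_def, List.filter_replicate]
  rw [h1, h2, encodePair]
  simp

/-! ### The modulus -/

/-- Primality test by trial division. -/
def testPrime (m : ℕ) : Bool :=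
  decide (2 ≤ m) && (List.range m).all fun k => !(decide (2 ≤ k) && decide (m % k = 0))

theorem testPrime_iff {m : ℕ} : testPrime m = true ↔ m.Prime := by
  simp only [testPrime, Bool.and_eq_true, decide_eq_true_eq, List.all_eq_true, List.mem_range,
    Bool.not_eq_true', Bool.and_eq_false_iff, decide_eq_false_iff_not, ← Nat.dvd_iff_mod_eq_zero,
    Nat.prime_def_lt]
  refine and_congr_right fun hm => forall₂_congr fun k hk => ⟨fun h hd => ?_, fun h => ?_⟩
  · have : k ≠ 0 := by
      rintro rfl
      rw [zero_dvd_iff] at hd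
      omega
    rcases h with h | h
    · omega
    · exact absurd hd h
  · by_cases hd : k ∣ m
    · exact Or.inl (by rw [h hd]; omega)
    · exact Or.inr hd

/-- The least prime number greater than `2 * n`. It exists below `4 * n + 3` by Bertrand's
postulate. -/
def largePrime (n : ℕ) : ℕ :=
  ((List.range (4 * n + 3)).filter fun m => decide (2 * n < m) && testPrime m).headD 0

theorem largePrime_spec (n : ℕ) :
    (largePrime n).Prime ∧ 2 * n < largePrime n ∧ largePrime n < 4 * n + 3 := by
  obtain ⟨p, hp, h1, h2⟩ := Nat.exists_prime_lt_and_le_two_mul (2 * n + 1) (by omega)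
  have hmem : p ∈ (List.range (4 * n + 3)).filter fun m => decide (2 * n < m) && testPrime m := by
    rw [List.mem_filter, List.mem_range, Bool.and_eq_true, decide_eq_true_eq, testPrime_iff]
    exact ⟨by omega, by omega, hp⟩
  have hl : largePrime n ∈
      (List.range (4 * n + 3)).filter fun m => decide (2 * n < m) && testPrime m := by
    unfold largePrime
    generalize ((List.range (4 * n + 3)).filter fun m => decide (2 * n < m) && testPrime m) = l at hmem
    rcases l with _ | ⟨a, l⟩
    · simp at hmem
    · exact List.mem_cons_self
  rw [List.mem_filter, List.mem_range, Bool.and_eq_true, decide_eq_true_eq, testPrime_iff] at hl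
  exact ⟨hl.2.2, hl.2.1, hl.1⟩

theorem PolyTime.largePrime : PolyTime largePrime := by
  unfold _root_.largePrime testPrime
  fun_prop

/-! ### The size of the kernel -/

/-- The bound on the size of the kernel, where all allowed values have at most `n.size + c` binary
digits. -/
def kernelSize (d c n : ℕ) : ℕ :=
  (n ^ d + 1) * (2 * n * (2 * n.size + 3) + d * (2 * (n.size + c) + 2) + 3) + 1 + n

theorem length_encodeList {α : Type} (e : α → List Bool) (l : List α) :
    (encodeList e l).length = (l.map fun a => (e a).length + 1).sum + 1 := by
  simp [encodeList, List.length_flatMap]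

theorem length_encodeList_le {α : Type} {e : α → List Bool} {l : List α} {B : ℕ}
    (h : ∀ a ∈ l, (e a).length ≤ B) : (encodeList e l).length ≤ l.length * (B + 1) + 1 := by
  rw [length_encodeList]
  have := List.sum_le_card_nsmul (l.map fun a => (e a).length + 1) (B + 1) (by
    simp only [List.forall_mem_map]
    exact fun a ha => Nat.succ_le_succ (h a ha))
  simpa using this

theorem length_encodeNat (m : ℕ) : (encodeNat m).length = 2 * m.size + 1 := by
  rw [encodeNat, length_encodeList, ← Nat.size_eq_bits_len]
  simp; omega

theorem ConstrainedClause.length_literals_le {d n : ℕ} (c : ConstrainedClause d n) :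
    c.literals.length ≤ 2 * n := by
  simpa [mul_comm] using c.literals_nodup.length_le_card

theorem length_encode_le {d n c : ℕ} (J : GenSatInstance d n) (hJ : J.clauses.length ≤ n ^ d + 1)
    (hs : ∀ C ∈ J.clauses, ∀ s ∈ C.allowed, s.size ≤ n.size + c) :
    J.encode.length + n ≤ kernelSize d c n := by
  have hc : ∀ C ∈ J.clauses, C.encode.length ≤
      2 * n * (2 * n.size + 3) + d * (2 * (n.size + c) + 2) + 2 := by
    intro C hC
    have h1 : (encodeList encodeLiteral C.literals).length ≤ C.literals.length * (2 * n.size + 3) + 1 :=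
      length_encodeList_le fun l _ => by
        rw [encodeLiteral, List.length_append, length_encodeNat]
        have := Nat.size_le_size l.1.2.le
        simp; omega
    have h2 : (encodeList encodeNat C.allowed).length ≤
        C.allowed.length * (2 * (n.size + c) + 2) + 1 :=
      length_encodeList_le fun s hs' => by
        rw [length_encodeNat]
        have := hs C hC s hs'
        omega
    have h3 := Nat.mul_le_mul_right (2 * n.size + 3) C.length_literals_le
    have h4 := Nat.mul_le_mul_right (2 * (n.size + c) + 2) C.allowed_length
    rw [ConstrainedClause.encode, List.length_append]
    omega
  have h1 : J.encode.length ≤ J.clauses.length *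
      (2 * n * (2 * n.size + 3) + d * (2 * (n.size + c) + 2) + 3) + 1 := length_encodeList_le hc
  have h2 := Nat.mul_le_mul_right
    (2 * n * (2 * n.size + 3) + d * (2 * (n.size + c) + 2) + 3) hJ
  unfold kernelSize
  omega

theorem primrec_size : Primrec Nat.size := by
  have hpow : Primrec₂ ((· ^ ·) : ℕ → ℕ → ℕ) := Primrec₂.unpaired'.1 Nat.Primrec.pow
  have h : Primrec fun n : ℕ => Nat.findGreatest (fun m => 2 ^ m ≤ 2 * n) n :=
    Primrec.nat_findGreatest (p := fun n m : ℕ => 2 ^ m ≤ 2 * n) Primrec.id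
      (Primrec.nat_le.comp (hpow.comp (Primrec.const 2) Primrec.snd)
        (Primrec.nat_mul.comp (Primrec.const 2) Primrec.fst))
  refine h.of_eq fun n => ?_
  have key : ∀ m, m ≠ 0 → (2 ^ m ≤ 2 * n ↔ m ≤ n.size) := by
    intro m hm
    obtain ⟨k, rfl⟩ := Nat.exists_eq_succ_of_ne_zero hm
    rw [pow_succ, mul_comm, Nat.mul_le_mul_left_iff two_pos, ← Nat.lt_size, Nat.succ_le_iff]
  rw [Nat.findGreatest_eq_iff]
  refine ⟨Nat.size_le.2 Nat.lt_two_pow_self, fun h => (key _ h).2 le_rfl, fun m hm hmn h => ?_⟩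
  have := (key m (by omega)).1 h
  omega

theorem computable_kernelSize (d c : ℕ) : Computable (kernelSize d c) := by
  refine Primrec.to_comp ?_
  have hid : Primrec fun n : ℕ => n := Primrec.id
  have hpow : Primrec₂ ((· ^ ·) : ℕ → ℕ → ℕ) := Primrec₂.unpaired'.1 Nat.Primrec.pow
  have add : ∀ {f g : ℕ → ℕ}, Primrec f → Primrec g → Primrec fun n => f n + g n :=
    fun hf hg => Primrec.nat_add.comp hf hg
  have mul : ∀ {f g : ℕ → ℕ}, Primrec f → Primrec g → Primrec fun n => f n * g n :=
    fun hf hg => Primrec.nat_mul.comp hf hg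
  have const : ∀ k : ℕ, Primrec fun _ : ℕ => k := fun k => Primrec.const k
  exact add (add (mul (add (hpow.comp hid (const d)) (const 1)) (add (add
    (mul (mul (const 2) hid) (add (mul (const 2) primrec_size) (const 3)))
    (mul (const d) (add (mul (const 2) (add primrec_size (const c))) (const 2)))) (const 3)))
    (const 1)) hid

theorem kernelSize_le (d c : ℕ) {n : ℕ} (hn : 1 ≤ n) :
    kernelSize d c n ≤ (2 * (2 * (2 + 3) + d * (2 * (1 + c) + 2) + 3) + 2) * (n ^ (d + 1) * n.size) := by
  have hs : 1 ≤ n.size := Nat.size_pos.2 hn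
  have hp : 1 ≤ n ^ d := Nat.one_le_pow _ _ hn
  have hns : 1 ≤ n * n.size := Nat.mul_pos hn hs
  have h1 : n.size ≤ n * n.size := Nat.le_mul_of_pos_left _ hn
  have h2 : n ≤ n * n.size := Nat.le_mul_of_pos_right _ hs
  have h3 : 2 * n * (2 * n.size + 3) + d * (2 * (n.size + c) + 2) + 3 ≤
      (2 * (2 + 3) + d * (2 * (1 + c) + 2) + 3) * (n * n.size) := by
    have h4 : d * (2 * (n.size + c) + 2) ≤ d * ((2 * (1 + c) + 2) * (n * n.size)) := by
      refine Nat.mul_le_mul_left d ?_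
      nlinarith [Nat.mul_le_mul_left c hns]
    nlinarith
  have h5 : n * n.size ≤ n ^ (d + 1) * n.size := by
    rw [pow_succ, mul_assoc]
    exact Nat.le_mul_of_pos_left _ hp
  have h6 : (n ^ d + 1) * (2 * n * (2 * n.size + 3) + d * (2 * (n.size + c) + 2) + 3) ≤
      (2 * n ^ d) * ((2 * (2 + 3) + d * (2 * (1 + c) + 2) + 3) * (n * n.size)) :=
    Nat.mul_le_mul (by omega) h3
  have h7 : (2 * n ^ d) * ((2 * (2 + 3) + d * (2 * (1 + c) + 2) + 3) * (n * n.size)) =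
      (2 * (2 * (2 + 3) + d * (2 * (1 + c) + 2) + 3)) * (n ^ (d + 1) * n.size) := by
    ring
  unfold kernelSize
  rw [add_mul _ 2]
  omega

theorem size_le_log {n : ℕ} (hn : 2 ≤ n) : (n.size : ℝ) ≤ 2 / Real.log 2 * Real.log n := by
  have hl : 0 < Real.log 2 := Real.log_pos one_lt_two
  have h1 : 2 ^ (n.size - 1) ≤ n := Nat.lt_size.1 (by
    have := Nat.size_pos.2 (by omega : 0 < n)
    omega)
  have h2 : ((n.size - 1 : ℕ) : ℝ) * Real.log 2 ≤ Real.log n := by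
    rw [← Real.log_pow]
    exact Real.log_le_log (by positivity) (by exact_mod_cast h1)
  have h3 : Real.log 2 ≤ Real.log n := Real.log_le_log two_pos (by exact_mod_cast hn)
  have h4 : (n.size : ℝ) ≤ ((n.size - 1 : ℕ) : ℝ) + 1 := by
    exact_mod_cast (by omega : n.size ≤ n.size - 1 + 1)
  rw [div_mul_eq_mul_div, le_div_iff₀ hl]
  nlinarith

theorem isBigO_kernelSize (d c : ℕ) :
    (fun n : ℕ => (kernelSize d c n : ℝ)) =O[Filter.atTop]
      fun n : ℕ => (n : ℝ) ^ (d + 1) * Real.log (n : ℝ) := by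
  refine Asymptotics.IsBigO.of_bound
    ((2 * (2 * (2 + 3) + d * (2 * (1 + c) + 2) + 3) + 2 : ℕ) * (2 / Real.log 2)) ?_
  filter_upwards [Filter.eventually_ge_atTop 2] with n hn
  have h1 : (kernelSize d c n : ℝ) ≤ (2 * (2 * (2 + 3) + d * (2 * (1 + c) + 2) + 3) + 2 : ℕ) *
      ((n : ℝ) ^ (d + 1) * n.size) := by
    exact_mod_cast kernelSize_le d c (by omega : 1 ≤ n)
  have hlog : 0 ≤ Real.log n := Real.log_natCast_nonneg n
  rw [Real.norm_of_nonneg (by positivity), Real.norm_of_nonneg (by positivity)]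
  refine h1.trans ?_
  rw [mul_assoc]
  refine mul_le_mul_of_nonneg_left ?_ (by positivity)
  rw [mul_left_comm]
  exact mul_le_mul_of_nonneg_left (size_le_log hn) (by positivity)

/-! ### The kernels -/

/-- The instance with one empty clause without allowed values. -/
def unsatInstance (d n : ℕ) : GenSatInstance d n where
  clauses := [⟨[], by simp, [], by simp, by simp⟩]
  clauses_distinct := List.pairwise_singleton _ _

theorem exists_kernelWord_eq (d : ℕ) {q : ℕ → ℕ} (hq : ∀ n, (q n).Prime) (x : List Bool) (n : ℕ) :
    ∃ J : GenSatInstance d n, kernelWord d q x n = J.encode ∧ J.clauses.length ≤ n ^ d + 1 ∧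
      (∀ C ∈ J.clauses, ∀ s ∈ C.allowed, s < q n) ∧
      (J.SatisfiableMod (q n) ↔
        ∃ I : GenSatInstance d n, x = I.encode ∧ I.SatisfiableMod (q n)) := by
  have := Fact.mk (hq n)
  by_cases hx : ∃ I : GenSatInstance d n, x = I.encode
  · obtain ⟨I, rfl⟩ := hx
    obtain ⟨J, h1, h2, h3, h4⟩ := exists_sparsify_instance (q := q n) I
    have hd : decodeRaw I.encode = some (I.clauses.map ConstrainedClause.raw, []) :=
      (isDecoder_decodeRaw.eq_some_iff _ _ _).2 (by rw [List.append_nil, I.encode_eq])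
    have hv : validRaw d n (I.clauses.map ConstrainedClause.raw) = true :=
      validRaw_iff.2 ⟨I, rfl⟩
    refine ⟨J, ?_, h2, h3, h4.trans ⟨fun h => ⟨I, rfl, h⟩, ?_⟩⟩
    · rw [J.encode_eq, h1, kernelWord, hd, Option.caseOption_some, hv]
      rfl
    · rintro ⟨I', he, h⟩
      rwa [GenSatInstance.encode_injective he]
  · have hk : kernelWord d q x n = encodeList RawClause.encode [([], [])] := by
      rw [kernelWord]
      rcases hd : decodeRaw x with _ | ⟨cs, u⟩
      · rfl
      rw [Option.caseOption_some]
      rcases u with _ | ⟨b, u⟩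
      · cases hv : validRaw d n cs
        · rfl
        · obtain ⟨I, rfl⟩ := validRaw_iff.1 hv
          refine absurd ⟨I, ?_⟩ hx
          rw [(isDecoder_decodeRaw.eq_some_iff _ _ _).1 hd, List.append_nil, I.encode_eq]
      · rfl
    refine ⟨unsatInstance d n, ?_, by simp [unsatInstance], by simp [unsatInstance], ?_⟩
    · rw [hk, GenSatInstance.encode_eq]
      rfl
    · constructor
      · rintro ⟨τ, h⟩
        simpa using h _ (List.mem_singleton.2 rfl)
      · rintro ⟨I, he, -⟩
        exact absurd ⟨I, he⟩ hx

/-- The satisfiability problem modulo a prime `q n` that depends on the number of variables has a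
sparse kernel if `q n` is computable in polynomial time and has `O(log n)` binary digits. -/
theorem hasSparseKernel_of_modulus {d : ℕ} {Q : ParamProblem} {q : ℕ → ℕ} (hq : PolyTime q)
    (hprime : ∀ n, (q n).Prime) (c : ℕ) (hsize : ∀ n, (q n).size ≤ n.size + c)
    (hQ : ∀ x n, (x, n) ∈ Q ↔ ∃ I : GenSatInstance d n, x = I.encode ∧ I.SatisfiableMod (q n)) :
    HasSparseKernel d Q := by
  have hlen : ∀ x n, (kernelWord d q x n).length + n ≤ kernelSize d c n := by
    intro x n
    obtain ⟨J, h1, h2, h3, -⟩ := exists_kernelWord_eq d hprime x n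
    rw [h1]
    exact length_encode_le J h2 fun C hC s hs =>
      (Nat.size_le_size (h3 C hC s hs).le).trans (hsize n)
  refine ⟨fun y => (kernelWord d q y.1 y.2, y.2), kernelSize d c, ⟨computable_kernelSize d c, ?_,
    fun x n => (Nat.le_add_right _ _).trans (hlen x n),
    fun x n => (Nat.le_add_left _ _).trans (hlen x n), fun x n => ?_⟩, isBigO_kernelSize d c,
    fun x n => ?_⟩
  · have h := PolyTime.kernelWord d hq fun n => (hprime n).pos
    exact PolyTime.nonempty_tm2_encodePair (by fun_prop)
  · obtain ⟨J, h1, -, -, h4⟩ := exists_kernelWord_eq d hprime x n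
    rw [hQ, hQ, ← h4, h1]
    constructor
    · rintro ⟨I, he, h⟩
      rwa [GenSatInstance.encode_injective he]
    · exact fun h => ⟨J, rfl, h⟩
  · obtain ⟨J, h1, h2, -, -⟩ := exists_kernelWord_eq d hprime x n
    exact ⟨J, congrArg (·, n) h1, h2⟩

theorem corollary3 (d : ℕ) :
    HasSparseKernel d (genSat d) ∧
      ∀ p : ℕ, p.Prime → HasSparseKernel d (genSatMod d p) := by
  constructor
  · refine hasSparseKernel_of_modulus PolyTime.largePrime (fun n => (largePrime_spec n).1) 3
      (fun n => ?_) fun x n => ?_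
    · rw [Nat.size_le]
      have h1 := (largePrime_spec n).2.2
      have h2 := Nat.lt_size_self n
      rw [pow_add]
      omega
    · refine exists_congr fun I => and_congr_right fun _ => exists_congr fun τ =>
        forall₂_congr fun C _ => ?_
      -- A clause has at most `2 * n` literals, so that its count is its own remainder.
      have h1 : C.numSat τ ≤ 2 * n := List.countP_le_length.trans C.length_literals_le
      rw [Nat.mod_eq_of_lt (h1.trans_lt (largePrime_spec n).2.1)]
  · intro p hp
    exact hasSparseKernel_of_modulus (PolyTime.const p) (fun _ => hp) p.size
      (fun n => Nat.le_add_left _ _) fun x n => Iff.rfl
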